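/- **Model.** Let $G=(V,E)$ be a connected finite simple graph, $n=|V|$, $m=|E|$, and let $\mathsf{Diam}$ be its diameter. Each node numbers its incident links (ports) arbitrarily, and one node $r$ is distinguished as the leader. In each synchronous round every node may send one message (a bit string) through each of its ports. All nodes run the same deterministic program; a node initially knows only its degree and whether it is the leader. The leader starts spontaneously, and every other node acts only in response to messages received. For nodes $x,y$ write $x\sim y$ if for every $e\in E$ there is a path from $x$ to $y$ in $G-e$; the edge-biconnected components of $G$ are the equivalence classes of $\sim$. A bridge is an edge whose deletion disconnects $G$. **Algorithm.** A node acts as soon as it has the information it needs. 1. *BFS tree.* The leader $r$ is the root and sends "explore" to all neighbours. A node first reached by "explore" messages chooses one of their senders as its parent, informs that parent, and sends "explore" to all its other neighbours. 2. *Descendant counts.* Once the root knows its children, a request is downcast from it, and by a convergecast each node $v$ computes $\#desc(v)$, the number of its descendants in the tree including itself, as $1$ plus the sum of the values of its children, and reports it to its parent. 3. *Preorder.* The root takes label $1$. A node with label $\ell$ and children $c_1,c_2,\dots$ sends its child $c_i$ the label $\ell+1+\sum_{j<i}\#desc(c_j)$. 4. *Marking cycle edges.* Each node sends its label along its incident non-tree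 edges; a label $\ell$ received in this way counts as the pair $(\ell,\ell)$. A node with label $k$ waits for a message from every neighbour other than its parent. It lets $u$ be the minimum of $k$ and of the first entries of all pairs received, and $v$ the maximum of $k+\#desc-1$ and of the second entries. If $k\le u,v<k+\#desc$, it sends its parent (if any) a null message, and the edge to the parent is declared a bridge. Otherwise it sends the pair $(u,v)$ ("mark up to $\mathrm{LCA}(u,v)$") to its parent, and the edge to the parent is marked as a cycle edge. 5. *Component labels.* In a downcast from the root, the root and each node whose edge to its parent was declared a bridge take their own preorder label as component label, and every other node copies the component label of its parent. Each node sends its component label to all its neighbours, and terminates when it knows its own label and those of all its neighbours. It declares an incident edge a bridge if and only if the two endpoints have different labels. **Theorem.** There is an absolute constant $C$ such that, for every connected finite simple graph $G$, every port numbering and every leader $r$, this algorithm has the following properties. * Every message it ever sends has at most $C\lfloor\log_2 n\rfloor$ bits. * After at most $C\cdot\mathsf{Diam}$ rounds all nodes have terminated, no node changes its state and no message is sent any more; the total number of messages sent is at most $C\,m$. * At termination, the parent pointers form a breadth-first search tree of $G$ rooted at $r$. Every node stores the number of its descendants in this tree and its label in a preorder labelling of the tree by $1,\dots,n$ (the labels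 of the descendants of each node are consecutive and begin with its own label). * Each non-root node has declared the edge to its parent a bridge if and only if it is a bridge of $G$, and has marked it as a cycle edge if and only if it lies in a simple cycle of $G$. * Two nodes store the same component label if and only if they lie in the same edge-biconnected component. Each node declares an incident edge a bridge if and only if it is a bridge of $G$, and a non-bridge if and only if it lies in a simple cycle of $G$. -/

import Mathlib

/-! ### Binary codes for messages -/

/-- A self-delimiting binary code of a natural number: each binary digit is preceded by `true`, and
`false` marks the end. -/
def encodeNat (k : ℕ) : List Bool := k.bits.flatMap (fun b => [true, b]) ++ [false]

theorem encodeNat_append_inj {k k' : ℕ} {s s' : List Bool}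
    (h : encodeNat k ++ s = encodeNat k' ++ s') : k = k' ∧ s = s' := by
  have key : ∀ (l l' s s' : List Bool),
      l.flatMap (fun b => [true, b]) ++ [false] ++ s =
        l'.flatMap (fun b => [true, b]) ++ [false] ++ s' → l = l' ∧ s = s' := by
    intro l
    induction l with
    | nil => intro l' s s' h; cases l' <;> simp_all
    | cons b l ih =>
      intro l' s s' h
      cases l' with
      | nil => simp at h
      | cons b' l' =>
        have h' := ih l' s s' (by simp_all)
        simp_all
  have bits_inj : Function.Injective Nat.bits := by
    have hl : Function.LeftInverse (fun l : List Bool => l.foldr Nat.bit 0) Nat.bits := by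
      intro n
      induction n using Nat.binaryRec' with
      | zero => simp
      | bit b n hn ih => simp [Nat.bits_append_bit n b hn, ih]
    exact hl.injective
  obtain ⟨h1, h2⟩ := key _ _ _ _ h
  exact ⟨bits_inj h1, h2⟩

theorem flatMap_encodeNat_injective :
    Function.Injective (fun l : List ℕ => l.flatMap encodeNat) := by
  intro l
  induction l with
  | nil => intro l' h; cases l' <;> simp_all [encodeNat]
  | cons a l ih =>
    intro l' h
    cases l' with
    | nil => simp [encodeNat] at h
    | cons a' l' =>
      simp only [List.flatMap_cons] at h
      obtain ⟨h1, h2⟩ := encodeNat_append_inj h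
      rw [h1, ih h2]

/-! ### Synchronous networks and distributed protocols -/

/-- A port numbering of `G`: every node `v` has its own numbering `0, …, deg v - 1` of the links that
join it to its neighbours. -/
structure PortNumbering {V : Type*} (G : SimpleGraph V) where
  deg : V → ℕ
  link : ∀ v, Fin (deg v) ≃ G.neighborSet v

namespace PortNumbering

variable {V : Type*} {G : SimpleGraph V} (N : PortNumbering G)

/-- The neighbour of `v` behind port `p`. -/
def nbr (v : V) (p : Fin (N.deg v)) : V := (N.link v p).1

theorem adj_nbr (v : V) (p : Fin (N.deg v)) : G.Adj v (N.nbr v p) := (N.link v p).2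

/-- The number that the link behind port `p` of `v` has at its other end. -/
def back (v : V) (p : Fin (N.deg v)) : Fin (N.deg (N.nbr v p)) :=
  (N.link (N.nbr v p)).symm ⟨v, (N.adj_nbr v p).symm⟩

end PortNumbering

/-- A deterministic, event-driven protocol for synchronous networks with a leader. All nodes run the
same program. Initially a node knows only its degree `d` and whether it is the leader; it has no
identifier and no knowledge of the network. In each round it may send one message through each of
its ports. -/
structure Protocol where
  /-- the messages, with their representation as bit strings -/
  Msg : Type
  code : Msg → List Bool
  code_injective : Function.Injective code
  /-- the local states of a node of degree `d` -/
  State : ℕ → Type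
  /-- the state before the first round, and the messages sent in the first round -/
  start : ∀ d, Bool → State d × (Fin d → Option Msg)
  /-- only the leader starts spontaneously -/
  start_silent : ∀ d p, (start d false).2 p = none
  /-- the reaction to the messages that arrive in one round: the new state, and the messages that
  are sent in the next round -/
  receive : ∀ d, State d → (Fin d → Option Msg) → State d × (Fin d → Option Msg)
  /-- the states in which a node has terminated -/
  halted : ∀ d, State d → Bool

namespace Protocol

variable (P : Protocol) {V : Type*} {G : SimpleGraph V} (N : PortNumbering G)

/-- The local states of all nodes after some number of rounds, and the messages that are about to be
sent in the next round. -/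
structure Config where
  state : ∀ v, P.State (N.deg v)
  out : ∀ v, Fin (N.deg v) → Option P.Msg

variable {N} in
/-- One synchronous round: every message is delivered to the other end of its link, and the nodes
that receive at least one message react. The other nodes do nothing. -/
def round (c : P.Config N) : P.Config N :=
  let inbox : ∀ v, Fin (N.deg v) → Option P.Msg := fun v p => c.out (N.nbr v p) (N.back v p)
  let next := fun v =>
    if ∀ p, (inbox v p).isNone then (c.state v, fun _ => none)
    else P.receive (N.deg v) (c.state v) (inbox v)
  { state := fun v => (next v).1, out := fun v => (next v).2 }

/-- The execution with leader `r`: the configuration after `t` rounds. -/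
def run [DecidableEq V] (r : V) : ℕ → P.Config N
  | 0 =>
    let first := fun v => P.start (N.deg v) (decide (v = r))
    { state := fun v => (first v).1, out := fun v => (first v).2 }
  | t + 1 => P.round (run r t)

/-- The number of messages sent in the first `T` rounds. -/
def messageCount [DecidableEq V] [Fintype V] (r : V) (T : ℕ) : ℕ :=
  ∑ t ∈ Finset.range T, ∑ v : V,
    (Finset.univ.filter fun p => ((P.run N r t).out v p).isSome).card

end Protocol

/-! ### The edge-biconnectivity algorithm -/

namespace EdgeBiconnectivity

inductive Msg where
  /-- phase 1: "join the tree" -/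
  | explore
  /-- phase 1: "I am your child" -/
  | join
  /-- phase 2: "compute `#desc` of yourself" -/
  | compute
  /-- phase 2: "my `#desc` is `k`" -/
  | desc (k : ℕ)
  /-- phase 3: "set your preorder label to `l`" -/
  | setLabel (l : ℕ)
  /-- phase 4: "cross edge from `k`" -/
  | cross (k : ℕ)
  /-- phase 4: the null message -/
  | null
  /-- phase 4: "mark up to LCA(`u`, `v`)" -/
  | markUp (u v : ℕ)
  /-- phase 5: "my component is `c`" -/
  | component (c : ℕ)
  deriving DecidableEq

/-- The type of a message, followed by its contents. -/
def Msg.fields : Msg → List ℕ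
  | explore => [0]
  | join => [1]
  | compute => [2]
  | desc k => [3, k]
  | setLabel l => [4, l]
  | cross k => [5, k]
  | null => [6]
  | markUp u v => [7, u, v]
  | component c => [8, c]

def Msg.code (m : Msg) : List Bool := m.fields.flatMap encodeNat

theorem Msg.code_injective : Function.Injective Msg.code := by
  intro m m' h
  have h' : m.fields = m'.fields := flatMap_encodeNat_injective h
  cases m <;> cases m' <;> simp_all [Msg.fields]

def Msg.desc? : Msg → Option ℕ
  | desc k => some k
  | _ => none

def Msg.setLabel? : Msg → Option ℕ
  | setLabel l => some l
  | _ => none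

def Msg.component? : Msg → Option ℕ
  | component c => some c
  | _ => none

/-- What a phase 4 message contributes to the convergecast: nothing for a null message, and
otherwise a pair `(u, v)`. -/
def Msg.report? : Msg → Option (Option (ℕ × ℕ))
  | cross k => some (some (k, k))
  | null => some none
  | markUp u v => some (some (u, v))
  | _ => none

/-- The variables of a node of degree `d`. The value `none` means "not yet set", except that
`parent = none` for the root. -/
structure State (d : ℕ) where
  leader : Bool
  /-- all messages received so far, for each port -/
  heard : Fin d → List Msg
  /-- phase 1: whether the node is in the tree, and the port to its parent -/
  inTree : Bool
  parent : Option (Fin d)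
  /-- phase 2: whether the node has been asked for `#desc` and has asked its children -/
  asked : Bool
  numDesc : Option ℕ
  /-- phase 3 -/
  preLabel : Option ℕ
  /-- phase 4: `true` if the edge to the parent is a bridge, `false` if it is marked as a cycle
  edge -/
  underBridge : Option Bool
  /-- phase 5 -/
  comp : Option ℕ

/-- The messages to be sent through the ports of a node of degree `d`. -/
abbrev Outbox (d : ℕ) := Fin d → Option Msg

namespace State

variable {d : ℕ} (s : State d)

def heardFromParent {α : Type} (f : Msg → Option α) : Option α :=
  s.parent.bind fun p => (s.heard p).findSome? f

/-- The neighbour behind port `p` is a child in the tree. -/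
def isChild (p : Fin d) : Bool := Msg.join ∈ s.heard p

/-- Each neighbour other than the parent has told whether it is a child. -/
def knowsChildren : Bool :=
  ∀ p, s.parent ≠ some p → Msg.explore ∈ s.heard p ∨ Msg.join ∈ s.heard p

/-- The value of `#desc` reported through port `p`. -/
def childDesc (p : Fin d) : Option ℕ := (s.heard p).findSome? Msg.desc?

/-- The report received in phase 4 through port `p`. -/
def report (p : Fin d) : Option (Option (ℕ × ℕ)) := (s.heard p).findSome? Msg.report?

/-- The pairs received in phase 4 from children and through cross edges. -/
def pairs : List (ℕ × ℕ) :=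
  (List.finRange d).filterMap fun p => if s.parent = some p then none else (s.report p).join

/-- The component label received through port `p`. -/
def nbrComp (p : Fin d) : Option ℕ := (s.heard p).findSome? Msg.component?

/-- The verdict of the node on its edge behind port `p`: the edge is a bridge if its two endpoints
have different component labels. -/
def isBridgeAt (p : Fin d) : Bool := s.comp ≠ s.nbrComp p

/-- The node has terminated: it knows its own label and the labels of all its neighbours. -/
def halted : Bool := s.comp.isSome ∧ ∀ p, (s.nbrComp p).isSome

end State

variable {d : ℕ}

/-- Phase 1, construction of a BFS tree. A node enters the tree when it is the leader or is reached
by an `explore` message. Its parent is then some neighbour that has sent one. It tells its parent,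
and explores through all other ports. -/
def phase1 (s : State d) : State d × Outbox d :=
  let par := (List.finRange d).find? fun p => Msg.explore ∈ s.heard p
  if ¬ s.inTree ∧ (s.leader ∨ par.isSome) then
    ({ s with inTree := true, parent := par },
      fun p => if par = some p then some Msg.join else some Msg.explore)
  else (s, fun _ => none)

/-- Phase 2, downcast of the request for `#desc`. The root starts as soon as it knows its
children. -/
def phase2Down (s : State d) : State d × Outbox d :=
  if s.inTree ∧ s.knowsChildren ∧ ¬ s.asked ∧
      (s.leader ∨ (s.heardFromParent fun m => if m = Msg.compute then some () else none).isSome) then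
    ({ s with asked := true }, fun p => if s.isChild p then some Msg.compute else none)
  else (s, fun _ => none)

/-- Phase 2, convergecast of `#desc`. -/
def phase2Up (s : State d) : State d × Outbox d :=
  if s.asked ∧ s.numDesc = none ∧ ∀ p, s.isChild p → (s.childDesc p).isSome then
    let k := 1 + ∑ p with s.isChild p, (s.childDesc p).getD 0
    ({ s with numDesc := some k }, fun p => if s.parent = some p then some (Msg.desc k) else none)
  else (s, fun _ => none)

/-- Phase 3, downcast of preorder labels. A node that gets its label also sends it along its cross
edges, which is the first step of phase 4. -/
def phase3 (s : State d) : State d × Outbox d :=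
  match s.numDesc, s.preLabel, (if s.leader then some 1 else s.heardFromParent Msg.setLabel?) with
  | some _, none, some l =>
    ({ s with preLabel := some l }, fun p =>
      if s.parent = some p then none
      else if s.isChild p then
        some (Msg.setLabel (l + 1 + ∑ q with q < p ∧ s.isChild q, (s.childDesc q).getD 0))
      else some (Msg.cross l))
  | _, _, _ => (s, fun _ => none)

/-- Phase 4, convergecast that marks the cycle edges. A node with label `k` waits for a report from
all neighbours except its parent, and then aggregates the pairs that it has received, together with
the range `k, …, k + #desc - 1` of the labels of its own descendants. If the node is an ancestor of
both nodes of the resulting pair, then it sends the null message, and the edge to the parent is a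
bridge. Otherwise it passes the pair on, and the edge to the parent is a cycle edge. -/
def phase4 (s : State d) : State d × Outbox d :=
  match s.numDesc, s.preLabel, s.underBridge with
  | some n, some k, none =>
    if ∀ p, s.parent ≠ some p → (s.report p).isSome then
      let u := (s.pairs.map Prod.fst).foldl min k
      let v := (s.pairs.map Prod.snd).foldl max (k + n - 1)
      if (k ≤ u ∧ u < k + n) ∧ (k ≤ v ∧ v < k + n) then
        ({ s with underBridge := some true },
          fun p => if s.parent = some p then some Msg.null else none)
      else
        ({ s with underBridge := some false },
          fun p => if s.parent = some p then some (Msg.markUp u v) else none)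
    else (s, fun _ => none)
  | _, _, _ => (s, fun _ => none)

/-- Phase 5, downcast of the component labels. The root and every node below a bridge use their
preorder label as the label of their component; all other nodes take over the label of their
parent. Every node tells its label to all neighbours. -/
def phase5 (s : State d) : State d × Outbox d :=
  match s.preLabel, s.underBridge, s.comp,
    (if s.leader then s.preLabel else s.heardFromParent Msg.component?) with
  | some k, some b, none, some c' =>
    let c := if s.leader ∨ b then k else c'
    ({ s with comp := some c }, fun _ => some (Msg.component c))
  | _, _, _, _ => (s, fun _ => none)

/-- Sequential composition of two local actions. -/
def andThen (f g : State d → State d × Outbox d) (s : State d) : State d × Outbox d :=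
  let a := f s
  let b := g a.1
  (b.1, fun p => (a.2 p).or (b.2 p))

/-- A node performs all actions that have become possible. -/
def act : State d → State d × Outbox d :=
  andThen phase1 (andThen phase2Down (andThen phase2Up (andThen phase3 (andThen phase4 phase5))))

def initial (d : ℕ) (leader : Bool) : State d where
  leader := leader
  heard := fun _ => []
  inTree := false
  parent := none
  asked := false
  numDesc := none
  preLabel := none
  underBridge := none
  comp := none

def start (d : ℕ) (leader : Bool) : State d × Outbox d :=
  if leader then act (initial d true) else (initial d false, fun _ => none)

def receive (d : ℕ) (s : State d) (inbox : Outbox d) : State d × Outbox d :=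
  act { s with heard := fun p => s.heard p ++ (inbox p).toList }

/-- The distributed algorithm for edge-biconnectivity. -/
def algorithm : Protocol where
  Msg := Msg
  code := Msg.code
  code_injective := Msg.code_injective
  State := State
  start := start
  start_silent := fun _ _ => rfl
  receive := receive
  halted := fun _ => State.halted

end EdgeBiconnectivity

/-! ### Trees, preorders, components and cycles -/

/-- `x` and `y` are in the same edge-biconnected component: despite the removal of any one edge there
remains a path from `x` to `y`. -/
def SameEdgeComponent {V : Type*} (G : SimpleGraph V) (x y : V) : Prop :=
  ∀ e ∈ G.edgeSet, (G.deleteEdges {e}).Reachable x y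

/-- The edge `e` lies in a simple cycle of `G`. -/
def InSimpleCycle {V : Type*} (G : SimpleGraph V) (e : Sym2 V) : Prop :=
  ∃ (w : V) (c : G.Walk w w), c.IsCycle ∧ e ∈ c.edges

/-- The parent map `par` describes a breadth-first search tree of `G` with root `r`: every other node
has a neighbour as its parent, which is closer to the root by one. -/
def IsBFSTree {V : Type*} (G : SimpleGraph V) (r : V) (par : V → Option V) : Prop :=
  par r = none ∧
    ∀ v, v ≠ r → ∃ w, par v = some w ∧ G.Adj v w ∧ G.dist r v = G.dist r w + 1

/-- The descendants of `v`, including `v` itself. -/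
def descendants {V : Type*} (par : V → Option V) (v : V) : Set V :=
  {u | Relation.ReflTransGen (fun a b => par a = some b) u v}

/-- `l` is a preorder labelling by `1, …, n`: the labels of the descendants of each node `v` are
consecutive and begin with the label of `v`. -/
def IsPreorderLabelling {V : Type*} (par : V → Option V) (l : V → ℕ) : Prop :=
  Set.BijOn l Set.univ (Set.Icc 1 (Nat.card V)) ∧
    ∀ v, l '' descendants par v = Set.Ico (l v) (l v + (descendants par v).ncard)

/-!
The nodes compute a breadth-first search tree, and every node `v` learns the interval of preorder
labels of its subtree. The edge from `v` to its parent is a bridge if and only if no other edge leaves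
the subtree (`IsBFSTree.isBridge_iff_exits`), that is, if and only if all labels that `v` gathers in
phase 4 lie in its interval (`IsBFSTree.exits_eq_empty_iff_label`). A node may suppress the pairs of
a subtree that no non-tree edge leaves, because all labels in them lie in the interval of every
ancestor. Nodes in the same edge-biconnected component lie below the same bridges of the tree, and the
component label names the lowest of these bridges (`IsBFSTree.componentLabel_eq_iff`).

The execution follows a fixed schedule. The function `act` performs six actions one after another,
each of which happens once per node and depends only on variables that later actions leave alone
(`act_spec`). Nodes that receive nothing have nothing to do (`act_settled`), so that the execution may
be regarded as one in which all nodes act in all rounds (`act_before`). If two actions use the same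
port in the same round, then the later message is lost; hence it has to be shown that this never
happens. As earlier actions have precedence, the six actions can be analysed in turn for all rounds
at once, each by an induction along the tree: from the root for `canAsk_iff`, `labelsCorrectly` and
`namesCorrectly`, and from the leaves for `countsCorrectly` and `reportsCorrectly`. Each analysis gives
the exact round in which each node acts, and with it all messages sent (`emit1_eq`, …, `emit6_eq`); the
next one then knows which messages have arrived and that its own do not collide with earlier ones.

A node at distance `d` from the root enters the tree in round `d` and asks its children in round
`d + 2`. A convergecast passes a node one round after the last of its children, and a downcast takes
one round per edge. This gives the bound `nameTime_le` on the number of rounds. For the number of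
messages it suffices that a node sends only when it performs an action (`progress_act`), which
happens at most six times, and through each port at most once at a time.
-/

/-! ### Descendants in a breadth-first search tree -/

section Tree

variable {V : Type*} {G : SimpleGraph V} {r : V} {par : V → Option V}

theorem mem_descendants_self (v : V) : v ∈ descendants par v := Relation.ReflTransGen.refl

theorem mem_descendants_of_parent {a b v : V} (h : par a = some b) (hb : b ∈ descendants par v) :
    a ∈ descendants par v :=
  Relation.ReflTransGen.head h hb

theorem mem_descendants_iff_parent {a v : V} :
    a ∈ descendants par v ↔ a = v ∨ ∃ b, par a = some b ∧ b ∈ descendants par v :=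
  Relation.ReflTransGen.cases_head_iff

theorem mem_descendants_iff_child {a v : V} :
    a ∈ descendants par v ↔ a = v ∨ ∃ c, par c = some v ∧ a ∈ descendants par c := by
  constructor
  · intro h
    rcases Relation.ReflTransGen.cases_tail h with h | ⟨c, hc, hcv⟩
    · exact Or.inl h.symm
    · exact Or.inr ⟨c, hcv, hc⟩
  · rintro (rfl | ⟨c, hc, ha⟩)
    · exact mem_descendants_self a
    · exact Relation.ReflTransGen.tail ha hc

/-- Two ancestors of the same node are comparable. -/
theorem ancestors_total {a u v : V} (hu : a ∈ descendants par u) (hv : a ∈ descendants par v) :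
    u ∈ descendants par v ∨ v ∈ descendants par u :=
  Relation.ReflTransGen.total_of_right_unique
    (fun _ _ _ h h' => Option.some.inj (h.symm.trans h')) hu hv

namespace IsBFSTree

theorem ne_root (h : IsBFSTree G r par) {v w : V} (hv : par v = some w) : v ≠ r := by
  rintro rfl
  simp [h.1] at hv

theorem exists_parent (h : IsBFSTree G r par) {v : V} (hv : v ≠ r) : ∃ w, par v = some w :=
  let ⟨w, hw, _⟩ := h.2 v hv
  ⟨w, hw⟩

theorem adj (h : IsBFSTree G r par) {v w : V} (hv : par v = some w) : G.Adj v w := by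
  obtain ⟨w', hw', ha, -⟩ := h.2 v (h.ne_root hv)
  cases hv.symm.trans hw'
  exact ha

theorem dist_eq (h : IsBFSTree G r par) {v w : V} (hv : par v = some w) :
    G.dist r v = G.dist r w + 1 := by
  obtain ⟨w', hw', -, hd⟩ := h.2 v (h.ne_root hv)
  cases hv.symm.trans hw'
  exact hd

theorem root_induction (h : IsBFSTree G r par) {p : V → Prop} (root : p r)
    (step : ∀ v w, par v = some w → p w → p v) (v : V) : p v := by
  induction hn : G.dist r v using Nat.strong_induction_on generalizing v with
  | _ n ih =>
    by_cases hv : v = r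
    · exact hv ▸ root
    · obtain ⟨w, hw⟩ := h.exists_parent hv
      have := h.dist_eq hw
      exact step v w hw (ih _ (by omega) w rfl)

theorem dist_le_of_mem_descendants (h : IsBFSTree G r par) {a v : V} (ha : a ∈ descendants par v) :
    a = v ∨ G.dist r v < G.dist r a := by
  induction ha with
  | refl => exact Or.inl rfl
  | tail _ hc ih =>
    have := h.dist_eq hc
    rcases ih with rfl | ih <;> right <;> omega

theorem parent_notMem_descendants (h : IsBFSTree G r par) {v w : V} (hv : par v = some w) :
    w ∉ descendants par v := by
  intro hw
  have := h.dist_eq hv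
  rcases h.dist_le_of_mem_descendants hw with rfl | hw <;> omega

theorem mem_descendants_root (h : IsBFSTree G r par) (v : V) : v ∈ descendants par r :=
  h.root_induction (mem_descendants_self r) (fun _ _ hv hw => mem_descendants_of_parent hv hw) v

theorem root_mem_descendants_iff (h : IsBFSTree G r par) {v : V} :
    r ∈ descendants par v ↔ r = v := by
  rw [mem_descendants_iff_parent]
  simp [h.1]

theorem eq_of_mem_descendants_siblings (h : IsBFSTree G r par) {a c c' v : V}
    (hc : par c = some v) (hc' : par c' = some v)
    (ha : a ∈ descendants par c) (ha' : a ∈ descendants par c') : c = c' := by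
  have key : ∀ {c c'}, par c = some v → par c' = some v → c ∈ descendants par c' → c = c' := by
    intro c c' hc hc' hcc
    have := h.dist_eq hc
    have := h.dist_eq hc'
    rcases h.dist_le_of_mem_descendants hcc with e | e
    · exact e
    · omega
  rcases ancestors_total ha ha' with e | e
  · exact key hc hc' e
  · exact (key hc' hc e).symm

theorem parent_asymm (h : IsBFSTree G r par) {a b : V} (hab : par a = some b) :
    par b ≠ some a := by
  intro hba
  have h1 := h.dist_eq hab
  have h2 := h.dist_eq hba
  omega

theorem leaf_induction [Finite V] (h : IsBFSTree G r par) {p : V → Prop}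
    (step : ∀ v, (∀ c, par c = some v → p c) → p v) (v : V) : p v := by
  induction hn : (descendants par v).ncard using Nat.strong_induction_on generalizing v with
  | _ n ih =>
    refine step v fun c hc => ih _ ?_ c rfl
    rw [← hn]
    refine Set.ncard_lt_ncard ?_ (Set.toFinite _)
    refine ⟨fun a ha => mem_descendants_iff_child.2 (Or.inr ⟨c, hc, ha⟩), fun hs => ?_⟩
    exact h.parent_notMem_descendants hc (hs (mem_descendants_self v))

end IsBFSTree

/-! ### Bridges and edge-biconnected components -/

/-- The nodes outside the subtree of `v` that are joined to a node of that subtree by an edge other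
than the one from `v` to its parent. -/
def exits (G : SimpleGraph V) (par : V → Option V) (v : V) : Set V :=
  {y | y ∉ descendants par v ∧ ∃ x ∈ descendants par v, G.Adj x y ∧ ¬(x = v ∧ par v = some y)}

theorem IsBFSTree.exits_root (h : IsBFSTree G r par) : exits G par r = ∅ :=
  Set.eq_empty_of_forall_notMem fun y hy => hy.1 (h.mem_descendants_root y)

/-- A non-tree edge that leaves the subtree of `v` starts at `v` or leaves the subtree of a
child. -/
theorem exits_cases {v y : V} (hy : y ∈ exits G par v) :
    (G.Adj v y ∧ par v ≠ some y ∧ par y ≠ some v) ∨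
      ∃ c, par c = some v ∧ y ∈ exits G par c := by
  obtain ⟨hyv, x, hx, hxy, hne⟩ := hy
  rcases mem_descendants_iff_child.1 hx with rfl | ⟨c, hc, hxc⟩
  · exact Or.inl ⟨hxy, fun hp => hne ⟨rfl, hp⟩,
      fun hp => hyv (mem_descendants_of_parent hp (mem_descendants_self x))⟩
  · refine Or.inr ⟨c, hc, fun hyc => hyv (mem_descendants_iff_child.2 (Or.inr ⟨c, hc, hyc⟩)), x,
      hxc, hxy, ?_⟩
    rintro ⟨-, hp⟩
    cases hc.symm.trans hp
    exact hyv (mem_descendants_self v)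

/-- If no edge but the one to the parent leaves the subtree of `v`, then every walk that leaves the
subtree uses that edge. -/
theorem mem_descendants_of_reachable_deleteEdges {v w : V} (hv : par v = some w)
    (he : exits G par v = ∅) {x y : V} (hx : x ∈ descendants par v)
    (hxy : (G.deleteEdges {s(v, w)}).Reachable x y) : y ∈ descendants par v := by
  obtain ⟨p⟩ := hxy
  induction p with
  | nil => exact hx
  | @cons x z y hxz _ ih =>
    refine ih (by_contra fun hz => ?_)
    rw [SimpleGraph.deleteEdges_adj] at hxz
    have : z ∈ exits G par v := by
      refine ⟨hz, x, hx, hxz.1, ?_⟩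
      rintro ⟨rfl, hp⟩
      cases hv.symm.trans hp
      exact hxz.2 rfl
    simp [he] at this

theorem IsBFSTree.reachable_of_mem_descendants (h : IsBFSTree G r par) {v w x : V}
    (hv : par v = some w) (hx : x ∈ descendants par v) :
    (G.deleteEdges {s(v, w)}).Reachable x v := by
  induction hx using Relation.ReflTransGen.head_induction_on with
  | refl => rfl
  | @head a b hab hb ih =>
    have hadj : (G.deleteEdges {s(v, w)}).Adj a b := by
      rw [SimpleGraph.deleteEdges_adj]
      refine ⟨h.adj hab, fun he => h.parent_notMem_descendants hv ?_⟩
      rcases Sym2.eq_iff.1 he with ⟨-, rfl⟩ | ⟨rfl, -⟩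
      · exact hb
      · exact mem_descendants_of_parent hab hb
    exact hadj.reachable.trans ih

theorem IsBFSTree.reachable_of_notMem_descendants (h : IsBFSTree G r par) {v w : V}
    (hv : par v = some w) (x : V) (hx : x ∉ descendants par v) :
    (G.deleteEdges {s(v, w)}).Reachable x r := by
  refine h.root_induction (p := fun x => x ∉ descendants par v →
    (G.deleteEdges {s(v, w)}).Reachable x r) (fun _ => .rfl) ?_ x hx
  intro a b hab ih ha
  have hadj : (G.deleteEdges {s(v, w)}).Adj a b := by
    rw [SimpleGraph.deleteEdges_adj]
    refine ⟨h.adj hab, fun he => ?_⟩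
    rcases Sym2.eq_iff.1 he with ⟨rfl, -⟩ | ⟨-, rfl⟩
    · exact ha (mem_descendants_self a)
    · exact ha (mem_descendants_of_parent hab (mem_descendants_self b))
  exact hadj.reachable.trans (ih fun hb => ha (mem_descendants_of_parent hab hb))

theorem IsBFSTree.isBridge_iff_exits (h : IsBFSTree G r par) {v w : V} (hv : par v = some w) :
    G.IsBridge s(v, w) ↔ exits G par v = ∅ := by
  rw [SimpleGraph.isBridge_iff]
  constructor
  · refine fun hb => Set.eq_empty_of_forall_notMem fun y hy => hb ?_
    obtain ⟨hy, x, hx, hxy, hne⟩ := hy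
    have hadj : (G.deleteEdges {s(v, w)}).Adj x y := by
      rw [SimpleGraph.deleteEdges_adj]
      refine ⟨hxy, fun he => ?_⟩
      rcases Sym2.eq_iff.1 he with ⟨rfl, rfl⟩ | ⟨-, rfl⟩
      · exact hne ⟨rfl, hv⟩
      · exact hy (mem_descendants_self y)
    exact (h.reachable_of_mem_descendants hv hx).symm.trans <| hadj.reachable.trans <|
      (h.reachable_of_notMem_descendants hv y hy).trans
        (h.reachable_of_notMem_descendants hv w (h.parent_notMem_descendants hv)).symm
  · exact fun he hr => h.parent_notMem_descendants hv
      (mem_descendants_of_reachable_deleteEdges hv he (mem_descendants_self v) hr)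

theorem SameEdgeComponent.trans {x y z : V} (hxy : SameEdgeComponent G x y)
    (hyz : SameEdgeComponent G y z) : SameEdgeComponent G x z :=
  fun e he => (hxy e he).trans (hyz e he)

theorem SameEdgeComponent.symm {x y : V} (hxy : SameEdgeComponent G x y) :
    SameEdgeComponent G y x :=
  fun e he => (hxy e he).symm

theorem sameEdgeComponent_iff_not_isBridge {x y : V} (hxy : G.Adj x y) :
    SameEdgeComponent G x y ↔ ¬ G.IsBridge s(x, y) := by
  rw [SimpleGraph.isBridge_iff, not_not]
  refine ⟨fun h => h _ hxy, fun h e _ => ?_⟩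
  by_cases he : e = s(x, y)
  · exact he ▸ h
  · refine SimpleGraph.Adj.reachable ?_
    rw [SimpleGraph.deleteEdges_adj]
    exact ⟨hxy, fun h => he h.symm⟩

theorem inSimpleCycle_iff_not_isBridge {e : Sym2 V} (he : e ∈ G.edgeSet) :
    InSimpleCycle G e ↔ ¬ G.IsBridge e := by
  rw [SimpleGraph.isBridge_iff_forall_cycle_notMem he]
  simp [InSimpleCycle]

end Tree

/-! ### Ports -/

namespace PortNumbering

variable {V : Type*} {G : SimpleGraph V} (N : PortNumbering G)

theorem nbr_injective (v : V) : Function.Injective (N.nbr v) :=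
  fun _ _ h => (N.link v).injective (Subtype.ext h)

@[simp]
theorem nbr_inj {v : V} {p q : Fin (N.deg v)} : N.nbr v p = N.nbr v q ↔ p = q :=
  (N.nbr_injective v).eq_iff

@[simp]
theorem nbr_back (v : V) (p : Fin (N.deg v)) : N.nbr (N.nbr v p) (N.back v p) = v := by
  have h := (N.link (N.nbr v p)).apply_symm_apply ⟨v, (N.adj_nbr v p).symm⟩
  exact congrArg Subtype.val h

theorem exists_port {v w : V} (h : G.Adj v w) : ∃ p, N.nbr v p = w :=
  ⟨(N.link v).symm ⟨w, h⟩, by simp [nbr]⟩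

end PortNumbering

/-! ### Preorder labels -/

section Preorder

variable {V : Type*} [Fintype V] {G : SimpleGraph V} (N : PortNumbering G) {r : V}
  (par : V → Option V)

open Classical in
/-- The number of descendants of the siblings of `v` that come before `v` in the port order of the
common parent. -/
noncomputable def elderDescendants (v : V) : ℕ :=
  match par v with
  | none => 0
  | some w => ∑ q with (∃ q', N.nbr w q' = v ∧ q < q') ∧ par (N.nbr w q) = some w,
      (descendants par (N.nbr w q)).ncard

open Classical in
/-- The preorder label of `v`, in closed form: the root contributes `1`, and every other ancestor
contributes `1` and the number of descendants of its elder siblings. -/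
noncomputable def preorderLabel (v : V) : ℕ :=
  ∑ u with v ∈ descendants par u, (1 + elderDescendants N par u)

variable {par}

theorem IsBFSTree.preorderLabel_root (h : IsBFSTree G r par) : preorderLabel N par r = 1 := by
  classical
  simp [preorderLabel, h.root_mem_descendants_iff, Finset.filter_eq, elderDescendants, h.1]

theorem IsBFSTree.preorderLabel_eq (h : IsBFSTree G r par) {v w : V} (hv : par v = some w) :
    preorderLabel N par v = preorderLabel N par w + 1 + elderDescendants N par v := by
  classical
  have : (Finset.univ.filter fun u => v ∈ descendants par u) =
      insert v (Finset.univ.filter fun u => w ∈ descendants par u) := by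
    ext u
    simp only [Finset.mem_filter, Finset.mem_univ, true_and, Finset.mem_insert]
    rw [mem_descendants_iff_parent]
    simp [hv, eq_comm]
  rw [preorderLabel, this, Finset.sum_insert, preorderLabel]
  · omega
  · simpa using h.parent_notMem_descendants hv

open Classical in
/-- The preorder label of a child, as its parent computes it. -/
theorem IsBFSTree.preorderLabel_child (h : IsBFSTree G r par) {w : V} {p : Fin (N.deg w)}
    (hp : par (N.nbr w p) = some w) :
    preorderLabel N par (N.nbr w p) = preorderLabel N par w + 1 +
      ∑ q with q < p ∧ par (N.nbr w q) = some w, (descendants par (N.nbr w q)).ncard := by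
  rw [h.preorderLabel_eq N hp, elderDescendants, hp]
  simp

open Classical in
theorem IsBFSTree.ncard_descendants (h : IsBFSTree G r par) (v : V) :
    (descendants par v).ncard =
      1 + ∑ p with par (N.nbr v p) = some v, (descendants par (N.nbr v p)).ncard := by
  have hset : descendants par v = insert v
      (↑((Finset.univ.filter fun p => par (N.nbr v p) = some v).biUnion
        fun p => (descendants par (N.nbr v p)).toFinset) : Set V) := by
    ext a
    rw [mem_descendants_iff_child]
    simp only [Set.mem_insert_iff, Finset.coe_biUnion, Finset.coe_filter, Finset.mem_univ, true_and,
      Set.mem_ofPred_eq, Set.coe_toFinset, Set.mem_iUnion, exists_prop]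
    refine or_congr Iff.rfl ⟨?_, ?_⟩
    · rintro ⟨c, hc, ha⟩
      obtain ⟨p, rfl⟩ := N.exists_port (h.adj hc).symm
      exact ⟨p, hc, ha⟩
    · rintro ⟨p, hp, ha⟩
      exact ⟨_, hp, ha⟩
  conv_lhs => rw [hset]
  rw [Set.ncard_insert_of_notMem, Set.ncard_coe_finset, Finset.card_biUnion, add_comm]
  · simp [Set.ncard_eq_toFinset_card']
  · intro p hp q hq hpq
    simp only [Finset.coe_filter, Finset.mem_univ, true_and, Set.mem_ofPred_eq] at hp hq
    rw [Function.onFun, Finset.disjoint_left]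
    intro a ha ha'
    simp only [Set.mem_toFinset] at ha ha'
    exact hpq ((N.nbr_inj).1 (h.eq_of_mem_descendants_siblings hp hq ha ha'))
  · simp only [Finset.coe_biUnion, Finset.coe_filter, Finset.mem_univ, true_and, Set.mem_ofPred_eq,
      Set.coe_toFinset, Set.mem_iUnion, exists_prop, not_exists, not_and]
    exact fun p hp => h.parent_notMem_descendants hp

/-- Consecutive intervals of lengths `f 0, f 1, …` tile an interval. -/
theorem exists_mem_consecutive_interval {d : ℕ} (f : Fin d → ℕ) (x : ℕ) :
    (∃ p, ∑ q with q < p, f q ≤ x ∧ x < ∑ q with q < p, f q + f p) ↔ x < ∑ q, f q := by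
  induction d with
  | zero => simp
  | succ d ih =>
    have hcast : ∀ p : Fin d, ∑ q with q < p.castSucc, f q = ∑ q with q < p, f q.castSucc := by
      intro p
      simp only [Finset.sum_filter, Fin.sum_univ_castSucc, Fin.castSucc_lt_castSucc_iff]
      simp [(Fin.castSucc_lt_last p).not_gt]
    have hlast : ∑ q with q < Fin.last d, f q = ∑ q : Fin d, f q.castSucc := by
      simp [Finset.sum_filter, Fin.sum_univ_castSucc, Fin.castSucc_lt_last]
    rw [Fin.exists_fin_succ', Fin.sum_univ_castSucc, hlast]
    simp only [hcast, ih (fun q => f q.castSucc)]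
    omega

/-- The intervals of the children of `v` tile the interval of `v` without its first element. -/
theorem IsBFSTree.image_preorderLabel (h : IsBFSTree G r par) (v : V) :
    preorderLabel N par '' descendants par v =
      Set.Ico (preorderLabel N par v) (preorderLabel N par v + (descendants par v).ncard) := by
  classical
  induction v using h.leaf_induction with
  | step v ih =>
    set L := preorderLabel N par
    have himage : ∀ x, x ∈ L '' descendants par v ↔
        x = L v ∨ ∃ p, par (N.nbr v p) = some v ∧ x ∈ L '' descendants par (N.nbr v p) := by
      intro x
      constructor
      · rintro ⟨a, ha, rfl⟩
        rcases mem_descendants_iff_child.1 ha with rfl | ⟨c, hc, ha⟩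
        · exact Or.inl rfl
        · obtain ⟨p, rfl⟩ := N.exists_port (h.adj hc).symm
          exact Or.inr ⟨p, hc, a, ha, rfl⟩
      · rintro (rfl | ⟨p, hp, a, ha, rfl⟩)
        · exact ⟨v, mem_descendants_self v, rfl⟩
        · exact ⟨a, mem_descendants_iff_child.2 (Or.inr ⟨_, hp, ha⟩), rfl⟩
    let f : Fin (N.deg v) → ℕ := fun p =>
      if par (N.nbr v p) = some v then (descendants par (N.nbr v p)).ncard else 0
    have hD : (descendants par v).ncard = 1 + ∑ p, f p := by
      rw [h.ncard_descendants N v, Finset.sum_filter]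
    have hL : ∀ p, par (N.nbr v p) = some v →
        L (N.nbr v p) = L v + 1 + ∑ q with q < p, f q := by
      intro p hp
      rw [show L (N.nbr v p) = _ from h.preorderLabel_child N hp, ← Finset.filter_filter,
        Finset.sum_filter
        (fun q => par (N.nbr v q) = some v)]
    ext x
    rw [himage, hD, Set.mem_Ico]
    have htile : (∃ p, par (N.nbr v p) = some v ∧ x ∈ L '' descendants par (N.nbr v p)) ↔
        L v + 1 ≤ x ∧ x - (L v + 1) < ∑ p, f p := by
      rw [← exists_mem_consecutive_interval]
      constructor
      · rintro ⟨p, hp, hx⟩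
        rw [ih _ hp, hL p hp, Set.mem_Ico] at hx
        refine ⟨by omega, p, ?_⟩
        simp only [show f p = (descendants par (N.nbr v p)).ncard from if_pos hp]
        omega
      · rintro ⟨hx, p, hp⟩
        have hpar : par (N.nbr v p) = some v := by
          by_contra hne
          simp only [show f p = 0 from if_neg hne] at hp
          omega
        refine ⟨p, hpar, ?_⟩
        simp only [show f p = (descendants par (N.nbr v p)).ncard from if_pos hpar] at hp
        rw [ih _ hpar, hL p hpar, Set.mem_Ico]
        omega
    rw [htile]
    omega

theorem IsBFSTree.isPreorderLabelling (h : IsBFSTree G r par) :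
    IsPreorderLabelling par (preorderLabel N par) := by
  refine ⟨?_, h.image_preorderLabel N⟩
  have hr : descendants par r = Set.univ := Set.eq_univ_of_forall h.mem_descendants_root
  have himage : preorderLabel N par '' Set.univ = Set.Icc 1 (Nat.card V) := by
    rw [← hr, h.image_preorderLabel N r, h.preorderLabel_root, hr, Set.ncard_univ]
    ext x
    simp only [Set.mem_Ico, Set.mem_Icc]
    omega
  refine ⟨fun x _ => himage ▸ Set.mem_image_of_mem _ trivial, ?_, himage.ge⟩
  refine Set.injOn_of_ncard_image_eq ?_ (Set.toFinite _)
  rw [himage, Set.ncard_univ, Set.ncard_eq_toFinset_card']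
  simp

theorem IsBFSTree.preorderLabel_injective (h : IsBFSTree G r par) :
    Function.Injective (preorderLabel N par) :=
  Set.injOn_univ.1 (h.isPreorderLabelling N).1.2.1

theorem IsBFSTree.preorderLabel_le_card (h : IsBFSTree G r par) (v : V) :
    preorderLabel N par v ≤ Fintype.card V := by
  have := (h.isPreorderLabelling N).1.1 (Set.mem_univ v)
  rw [Nat.card_eq_fintype_card] at this
  exact this.2

theorem IsBFSTree.mem_descendants_iff_label (h : IsBFSTree G r par) {a v : V} :
    a ∈ descendants par v ↔ preorderLabel N par v ≤ preorderLabel N par a ∧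
      preorderLabel N par a < preorderLabel N par v + (descendants par v).ncard := by
  rw [← Set.mem_Ico, ← h.image_preorderLabel N v, (h.preorderLabel_injective N).mem_set_image]

theorem ncard_descendants_pos (v : V) : 0 < (descendants par v).ncard :=
  (Set.ncard_pos (Set.toFinite _)).2 ⟨v, mem_descendants_self v⟩

end Preorder

/-! ### The values of the convergecast of phase 4, and the component labels -/

section Labels

variable {V : Type*} [Fintype V] {G : SimpleGraph V} (N : PortNumbering G) {r : V}
  (par : V → Option V)

/-- The labels that node `v` takes into account in phase 4: those of its descendants and those of
the nodes that can be reached from them by leaving the subtree along a non-tree edge. -/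
def reachedLabels (v : V) : Set ℕ :=
  preorderLabel N par '' (descendants par v ∪ exits G par v)

noncomputable def lowLabel (v : V) : ℕ := sInf (reachedLabels N par v)

noncomputable def highLabel (v : V) : ℕ := sSup (reachedLabels N par v)

/-- The component label of `v`: the label of the nearest ancestor that is the root or lies below a
bridge. Labels increase along each path from the root, so this is the largest label of such an
ancestor. -/
noncomputable def componentLabel (v : V) : ℕ :=
  sSup (preorderLabel N par '' {u | v ∈ descendants par u ∧ exits G par u = ∅})

variable {par}

theorem finite_reachedLabels (v : V) : (reachedLabels N par v).Finite :=
  (Set.toFinite _).image _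

theorem label_mem_reachedLabels (v : V) : preorderLabel N par v ∈ reachedLabels N par v :=
  ⟨v, Or.inl (mem_descendants_self v), rfl⟩

theorem isLeast_lowLabel (v : V) : IsLeast (reachedLabels N par v) (lowLabel N par v) :=
  ⟨Nat.sInf_mem ⟨_, label_mem_reachedLabels N v⟩, fun _ hx => Nat.sInf_le hx⟩

theorem isGreatest_highLabel (v : V) : IsGreatest (reachedLabels N par v) (highLabel N par v) :=
  ⟨Nat.sSup_mem ⟨_, label_mem_reachedLabels N v⟩ (finite_reachedLabels N v).bddAbove,
    fun _ hx => le_csSup (finite_reachedLabels N v).bddAbove hx⟩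

theorem IsBFSTree.le_card_of_mem_reachedLabels (h : IsBFSTree G r par) {v : V} {x : ℕ}
    (hx : x ∈ reachedLabels N par v) : x ≤ Fintype.card V := by
  obtain ⟨y, -, rfl⟩ := hx
  exact h.preorderLabel_le_card N y

/-- The test by which a node recognizes that its edge to the parent is a bridge. -/
theorem IsBFSTree.exits_eq_empty_iff_label (h : IsBFSTree G r par) (v : V) :
    exits G par v = ∅ ↔
      (preorderLabel N par v ≤ lowLabel N par v ∧
        lowLabel N par v < preorderLabel N par v + (descendants par v).ncard) ∧
      (preorderLabel N par v ≤ highLabel N par v ∧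
        highLabel N par v < preorderLabel N par v + (descendants par v).ncard) := by
  constructor
  · intro he
    have key : ∀ x ∈ reachedLabels N par v, preorderLabel N par v ≤ x ∧
        x < preorderLabel N par v + (descendants par v).ncard := by
      rintro x ⟨y, hy, rfl⟩
      rw [he, Set.union_empty] at hy
      exact (h.mem_descendants_iff_label N).1 hy
    exact ⟨key _ (isLeast_lowLabel N v).1, key _ (isGreatest_highLabel N v).1⟩
  · rintro ⟨⟨h1, -⟩, -, h2⟩
    refine Set.eq_empty_of_forall_notMem fun y hy => hy.1 ?_
    have hmem : preorderLabel N par y ∈ reachedLabels N par v := ⟨y, Or.inr hy, rfl⟩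
    exact (h.mem_descendants_iff_label N).2
      ⟨h1.trans ((isLeast_lowLabel N v).2 hmem), ((isGreatest_highLabel N v).2 hmem).trans_lt h2⟩

theorem IsBFSTree.reachedLabels_child_subset (h : IsBFSTree G r par) {c v : V}
    (hc : par c = some v) : reachedLabels N par c ⊆ reachedLabels N par v := by
  rintro _ ⟨y, hy, rfl⟩
  refine ⟨y, ?_, rfl⟩
  rcases hy with hy | ⟨hy, x, hx, hxy, hne⟩
  · exact Or.inl (mem_descendants_iff_child.2 (Or.inr ⟨c, hc, hy⟩))
  · by_cases hyv : y ∈ descendants par v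
    · exact Or.inl hyv
    · refine Or.inr ⟨hyv, x, mem_descendants_iff_child.2 (Or.inr ⟨c, hc, hx⟩), hxy, ?_⟩
      rintro ⟨rfl, -⟩
      exact h.parent_notMem_descendants hc hx

/-- The label at the other end of a non-tree edge may also belong to a descendant. -/
theorem cross_mem_reachedLabels {v y : V} (hadj : G.Adj v y) (hp : par v ≠ some y) :
    preorderLabel N par y ∈ reachedLabels N par v := by
  refine ⟨y, ?_, rfl⟩
  by_cases hy : y ∈ descendants par v
  · exact Or.inl hy
  · exact Or.inr ⟨hy, v, mem_descendants_self v, hadj, fun hc => hp hc.2⟩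

theorem IsBFSTree.label_le_of_mem_descendants (h : IsBFSTree G r par) {a v : V}
    (ha : a ∈ descendants par v) : preorderLabel N par v ≤ preorderLabel N par a :=
  ((h.mem_descendants_iff_label N).1 ha).1

theorem IsBFSTree.componentLabel_of_exits_eq_empty (h : IsBFSTree G r par) {v : V}
    (hv : exits G par v = ∅) : componentLabel N par v = preorderLabel N par v := by
  refine IsGreatest.csSup_eq ⟨⟨v, ⟨mem_descendants_self v, hv⟩, rfl⟩, ?_⟩
  rintro _ ⟨u, hu, rfl⟩
  exact h.label_le_of_mem_descendants N hu.1

theorem componentLabel_of_exits_ne_empty {v w : V} (hp : par v = some w)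
    (hv : exits G par v ≠ ∅) : componentLabel N par v = componentLabel N par w := by
  have : {u | v ∈ descendants par u ∧ exits G par u = ∅} =
      {u | w ∈ descendants par u ∧ exits G par u = ∅} := by
    ext u
    simp only [Set.mem_ofPred_eq]
    refine and_congr_left fun hu => ?_
    rw [mem_descendants_iff_parent]
    simp only [hp, Option.some.injEq, exists_eq_left', or_iff_right_iff_imp]
    rintro rfl
    exact absurd hu hv
  rw [componentLabel, this, componentLabel]

/-- The component label of a node is the preorder label of a node in the same component. -/
theorem IsBFSTree.exists_componentLabel (h : IsBFSTree G r par) (v : V) :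
    ∃ u, componentLabel N par v = preorderLabel N par u ∧ SameEdgeComponent G v u := by
  induction v using h.root_induction with
  | root => exact ⟨r, h.componentLabel_of_exits_eq_empty N h.exits_root, fun _ _ => .rfl⟩
  | step v w hp ih =>
    by_cases hv : exits G par v = ∅
    · exact ⟨v, h.componentLabel_of_exits_eq_empty N hv, fun _ _ => .rfl⟩
    · obtain ⟨u, hu, hc⟩ := ih
      refine ⟨u, (componentLabel_of_exits_ne_empty N hp hv).trans hu, .trans ?_ hc⟩
      rwa [sameEdgeComponent_iff_not_isBridge (h.adj hp), h.isBridge_iff_exits hp]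

theorem IsBFSTree.componentLabel_eq_iff (h : IsBFSTree G r par) (v w : V) :
    componentLabel N par v = componentLabel N par w ↔ SameEdgeComponent G v w := by
  constructor
  · intro he
    obtain ⟨a, ha, hva⟩ := h.exists_componentLabel N v
    obtain ⟨b, hb, hwb⟩ := h.exists_componentLabel N w
    cases h.preorderLabel_injective N (ha.symm.trans (he.trans hb))
    exact hva.trans hwb.symm
  · -- Nodes in the same component lie below the same bridges.
    have key : ∀ {v w}, SameEdgeComponent G v w → ∀ u, exits G par u = ∅ →
        v ∈ descendants par u → w ∈ descendants par u := by
      intro v w hvw u hu hv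
      by_cases hur : u = r
      · exact hur ▸ h.mem_descendants_root w
      · obtain ⟨u', hu'⟩ := h.exists_parent hur
        exact mem_descendants_of_reachable_deleteEdges hu' hu hv (hvw _ (h.adj hu'))
    intro hvw
    have : {u | v ∈ descendants par u ∧ exits G par u = ∅} =
        {u | w ∈ descendants par u ∧ exits G par u = ∅} := by
      ext u
      exact ⟨fun hu => ⟨key hvw u hu.2 hu.1, hu.2⟩, fun hu => ⟨key hvw.symm u hu.2 hu.1, hu.2⟩⟩
    rw [componentLabel, this, componentLabel]

end Labels

namespace EdgeBiconnectivity

/-! ### The local actions of a node -/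

variable {d : ℕ}

namespace State

/-- The port that becomes the port to the parent in phase 1. -/
def firstExplorer (s : State d) : Option (Fin d) :=
  (List.finRange d).find? fun p => Msg.explore ∈ s.heard p

/-- The node has what it needs to enter the tree. -/
def canJoin (s : State d) : Prop := s.leader ∨ s.firstExplorer.isSome

/-- The node has what it needs to ask its children for their numbers of descendants. -/
def canAsk (s : State d) : Prop :=
  s.inTree ∧ s.knowsChildren ∧
    (s.leader ∨ (s.heardFromParent fun m => if m = Msg.compute then some () else none).isSome)

/-- The node has what it needs to compute the number of its descendants. -/
def canCount (s : State d) : Prop := s.asked ∧ ∀ p, s.isChild p → (s.childDesc p).isSome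

/-- The node has what it needs to take its preorder label. -/
def canLabel (s : State d) : Prop :=
  s.numDesc.isSome ∧ (s.leader ∨ (s.heardFromParent Msg.setLabel?).isSome)

/-- The node has what it needs to classify the edge to its parent. -/
def canReport (s : State d) : Prop :=
  s.numDesc.isSome ∧ s.preLabel.isSome ∧ ∀ p, s.parent ≠ some p → (s.report p).isSome

/-- The node has what it needs to take its component label. -/
def canName (s : State d) : Prop :=
  s.preLabel.isSome ∧ s.underBridge.isSome ∧
    (s.leader ∨ (s.heardFromParent Msg.component?).isSome)

/-- The value of `#desc` that the node computes in phase 2. -/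
def newDesc (s : State d) : ℕ := 1 + ∑ p with s.isChild p, (s.childDesc p).getD 0

/-- The preorder label that the node takes in phase 3. -/
def newLabel (s : State d) : ℕ :=
  if s.leader then 1 else (s.heardFromParent Msg.setLabel?).getD 0

/-- The first entry of the pair that the node computes in phase 4. -/
def low (s : State d) : ℕ := (s.pairs.map Prod.fst).foldl min (s.preLabel.getD 0)

/-- The second entry of the pair that the node computes in phase 4. -/
def high (s : State d) : ℕ :=
  (s.pairs.map Prod.snd).foldl max (s.preLabel.getD 0 + s.numDesc.getD 0 - 1)

/-- The outcome of phase 4: no edge but the one to the parent leaves the subtree. -/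
def closed (s : State d) : Bool :=
  (s.preLabel.getD 0 ≤ s.low ∧ s.low < s.preLabel.getD 0 + s.numDesc.getD 0) ∧
    (s.preLabel.getD 0 ≤ s.high ∧ s.high < s.preLabel.getD 0 + s.numDesc.getD 0)

/-- The component label that the node takes in phase 5. -/
def newComp (s : State d) : ℕ :=
  if s.leader ∨ s.underBridge = some true then s.preLabel.getD 0
  else (s.heardFromParent Msg.component?).getD 0

/-- What the node sends when it enters the tree. -/
def joinOut (s : State d) : Outbox d := fun p =>
  if s.parent = some p then some Msg.join else some Msg.explore

/-- What the node sends when it asks its children for their numbers of descendants. -/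
def askOut (s : State d) : Outbox d := fun p => if s.isChild p then some Msg.compute else none

/-- What the node sends when it has counted its descendants. -/
def countOut (s : State d) : Outbox d := fun p =>
  if s.parent = some p then some (Msg.desc s.newDesc) else none

/-- What the node sends when it has taken its preorder label. -/
def labelOut (s : State d) : Outbox d := fun p =>
  if s.parent = some p then none
  else if s.isChild p then
    some (Msg.setLabel (s.newLabel + 1 + ∑ q with q < p ∧ s.isChild q, (s.childDesc q).getD 0))
  else some (Msg.cross s.newLabel)

/-- What the node sends when it has classified the edge to its parent. -/
def reportOut (s : State d) : Outbox d := fun p =>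
  if s.parent = some p then some (if s.closed then Msg.null else Msg.markUp s.low s.high) else none

/-- What the node sends when it has taken its component label. -/
def nameOut (s : State d) : Outbox d := fun _ => some (Msg.component s.newComp)

/-- The number of the six local actions that the node has performed. -/
def progress (s : State d) : ℕ :=
  s.inTree.toNat + s.asked.toNat + s.numDesc.isSome.toNat + s.preLabel.isSome.toNat +
    s.underBridge.isSome.toNat + s.comp.isSome.toNat

/-- No action is possible. -/
def Settled (s : State d) : Prop :=
  (s.canJoin → s.inTree) ∧ (s.canAsk → s.asked) ∧ (s.canCount → s.numDesc.isSome) ∧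
    (s.canLabel → s.preLabel.isSome) ∧ (s.canReport → s.underBridge.isSome) ∧
    (s.canName → s.comp.isSome)

end State

section PhaseEquations

open Classical

/-- Phase 1 as a guarded update; the other actions are put into the same form below. -/
theorem phase1_eq (s : State d) : phase1 s =
    if ¬ s.inTree ∧ s.canJoin then
      ({ s with inTree := true, parent := s.firstExplorer },
        State.joinOut { s with parent := s.firstExplorer })
    else (s, fun _ => none) := by
  unfold phase1 State.canJoin State.firstExplorer State.joinOut
  dsimp only
  split_ifs <;> rfl

theorem phase2Down_eq (s : State d) : phase2Down s =
    if ¬ s.asked ∧ s.canAsk then ({ s with asked := true }, s.askOut)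
    else (s, fun _ => none) := by
  unfold phase2Down State.canAsk State.askOut
  split_ifs <;> first | rfl | (exfalso; tauto)

theorem phase2Up_eq (s : State d) : phase2Up s =
    if s.numDesc = none ∧ s.canCount then ({ s with numDesc := some s.newDesc }, s.countOut)
    else (s, fun _ => none) := by
  unfold phase2Up State.canCount State.countOut State.newDesc
  split_ifs <;> first | rfl | (exfalso; tauto)

theorem phase3_eq (s : State d) : phase3 s =
    if s.preLabel = none ∧ s.canLabel then ({ s with preLabel := some s.newLabel }, s.labelOut)
    else (s, fun _ => none) := by
  unfold phase3 State.canLabel State.labelOut State.newLabel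
  cases h1 : s.numDesc <;> cases h2 : s.preLabel <;> cases h3 : s.leader <;>
    cases h4 : s.heardFromParent Msg.setLabel? <;> simp

theorem phase4_eq (s : State d) : phase4 s =
    if s.underBridge = none ∧ s.canReport then
      ({ s with underBridge := some s.closed }, s.reportOut)
    else (s, fun _ => none) := by
  unfold phase4 State.canReport State.reportOut State.closed State.low State.high
  cases h1 : s.numDesc <;> cases h2 : s.preLabel <;> cases h3 : s.underBridge <;> try simp
  split_ifs <;> simp_all

theorem phase5_eq (s : State d) : phase5 s =
    if s.comp = none ∧ s.canName then ({ s with comp := some s.newComp }, s.nameOut)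
    else (s, fun _ => none) := by
  unfold phase5 State.canName State.nameOut State.newComp
  cases h1 : s.preLabel <;> cases h2 : s.underBridge <;> cases h3 : s.comp <;>
    cases h4 : s.leader <;> cases h5 : s.heardFromParent Msg.component? <;> simp

end PhaseEquations

open Classical in
/-- The effect of `act`, which takes the state `s₀` to `s` and sends the messages `o`. No phase
modifies a variable that an earlier phase reads, so all conditions and new values can be read off
from the final state `s`. -/
structure ActSpec (s₀ s : State d) (o : Outbox d) : Prop where
  leader : s.leader = s₀.leader
  heard : s.heard = s₀.heard
  inTree : s.inTree = true ↔ s₀.inTree = true ∨ s.canJoin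
  parent : s.parent = if ¬ s₀.inTree ∧ s.canJoin then s.firstExplorer else s₀.parent
  asked : s.asked = true ↔ s₀.asked = true ∨ s.canAsk
  numDesc : s.numDesc = if s₀.numDesc = none ∧ s.canCount then some s.newDesc else s₀.numDesc
  preLabel : s.preLabel = if s₀.preLabel = none ∧ s.canLabel then some s.newLabel else s₀.preLabel
  underBridge : s.underBridge =
    if s₀.underBridge = none ∧ s.canReport then some s.closed else s₀.underBridge
  comp : s.comp = if s₀.comp = none ∧ s.canName then some s.newComp else s₀.comp
  out : ∀ p, o p =
    (if ¬ s₀.inTree ∧ s.canJoin then s.joinOut p else none).or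
    ((if ¬ s₀.asked ∧ s.canAsk then s.askOut p else none).or
    ((if s₀.numDesc = none ∧ s.canCount then s.countOut p else none).or
    ((if s₀.preLabel = none ∧ s.canLabel then s.labelOut p else none).or
    ((if s₀.underBridge = none ∧ s.canReport then s.reportOut p else none).or
    (if s₀.comp = none ∧ s.canName then s.nameOut p else none)))))

/-- Phase 1 changes only `inTree` and `parent`; each of the other actions changes a single variable. -/
theorem phase1_frame (s : State d) : (phase1 s).1.leader = s.leader ∧
    (phase1 s).1.heard = s.heard ∧ (phase1 s).1.asked = s.asked ∧
    (phase1 s).1.numDesc = s.numDesc ∧ (phase1 s).1.preLabel = s.preLabel ∧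
    (phase1 s).1.underBridge = s.underBridge ∧ (phase1 s).1.comp = s.comp := by
  rw [phase1_eq]; split_ifs <;> simp

theorem phase2Down_frame (s : State d) : (phase2Down s).1.leader = s.leader ∧
    (phase2Down s).1.heard = s.heard ∧ (phase2Down s).1.inTree = s.inTree ∧
    (phase2Down s).1.parent = s.parent ∧
    (phase2Down s).1.numDesc = s.numDesc ∧ (phase2Down s).1.preLabel = s.preLabel ∧
    (phase2Down s).1.underBridge = s.underBridge ∧ (phase2Down s).1.comp = s.comp := by
  rw [phase2Down_eq]; split_ifs <;> simp

theorem phase2Up_frame (s : State d) : (phase2Up s).1.leader = s.leader ∧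
    (phase2Up s).1.heard = s.heard ∧ (phase2Up s).1.inTree = s.inTree ∧
    (phase2Up s).1.parent = s.parent ∧
    (phase2Up s).1.asked = s.asked ∧ (phase2Up s).1.preLabel = s.preLabel ∧
    (phase2Up s).1.underBridge = s.underBridge ∧ (phase2Up s).1.comp = s.comp := by
  rw [phase2Up_eq]; split_ifs <;> simp

theorem phase3_frame (s : State d) : (phase3 s).1.leader = s.leader ∧
    (phase3 s).1.heard = s.heard ∧ (phase3 s).1.inTree = s.inTree ∧
    (phase3 s).1.parent = s.parent ∧
    (phase3 s).1.asked = s.asked ∧ (phase3 s).1.numDesc = s.numDesc ∧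
    (phase3 s).1.underBridge = s.underBridge ∧ (phase3 s).1.comp = s.comp := by
  rw [phase3_eq]; split_ifs <;> simp

theorem phase4_frame (s : State d) : (phase4 s).1.leader = s.leader ∧
    (phase4 s).1.heard = s.heard ∧ (phase4 s).1.inTree = s.inTree ∧
    (phase4 s).1.parent = s.parent ∧
    (phase4 s).1.asked = s.asked ∧ (phase4 s).1.numDesc = s.numDesc ∧
    (phase4 s).1.preLabel = s.preLabel ∧ (phase4 s).1.comp = s.comp := by
  rw [phase4_eq]; split_ifs <;> simp

theorem phase5_frame (s : State d) : (phase5 s).1.leader = s.leader ∧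
    (phase5 s).1.heard = s.heard ∧ (phase5 s).1.inTree = s.inTree ∧
    (phase5 s).1.parent = s.parent ∧
    (phase5 s).1.asked = s.asked ∧ (phase5 s).1.numDesc = s.numDesc ∧
    (phase5 s).1.preLabel = s.preLabel ∧ (phase5 s).1.underBridge = s.underBridge := by
  rw [phase5_eq]; split_ifs <;> simp


section PhaseEffects

open Classical

theorem phase1_effect (s : State d) :
    ((phase1 s).1.inTree = true ↔ s.inTree = true ∨ s.canJoin) ∧
    ((phase1 s).1.parent = if ¬ s.inTree ∧ s.canJoin then s.firstExplorer else s.parent) ∧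
    ∀ p, (phase1 s).2 p = if ¬ s.inTree ∧ s.canJoin then (phase1 s).1.joinOut p else none := by
  rw [phase1_eq]
  split_ifs with h
  · exact ⟨⟨fun _ => Or.inr h.2, fun _ => rfl⟩, rfl, fun _ => rfl⟩
  · exact ⟨by tauto, rfl, fun _ => rfl⟩

theorem phase2Down_effect (s : State d) :
    ((phase2Down s).1.asked = true ↔ s.asked = true ∨ s.canAsk) ∧
    ∀ p, (phase2Down s).2 p = if ¬ s.asked ∧ s.canAsk then s.askOut p else none := by
  rw [phase2Down_eq]
  split_ifs with h
  · exact ⟨⟨fun _ => Or.inr h.2, fun _ => rfl⟩, fun _ => rfl⟩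
  · exact ⟨by tauto, fun _ => rfl⟩

theorem phase2Up_effect (s : State d) :
    ((phase2Up s).1.numDesc =
      if s.numDesc = none ∧ s.canCount then some s.newDesc else s.numDesc) ∧
    ∀ p, (phase2Up s).2 p = if s.numDesc = none ∧ s.canCount then s.countOut p else none := by
  rw [phase2Up_eq]
  split_ifs <;> exact ⟨rfl, fun _ => rfl⟩

theorem phase3_effect (s : State d) :
    ((phase3 s).1.preLabel =
      if s.preLabel = none ∧ s.canLabel then some s.newLabel else s.preLabel) ∧
    ∀ p, (phase3 s).2 p = if s.preLabel = none ∧ s.canLabel then s.labelOut p else none := by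
  rw [phase3_eq]
  split_ifs <;> exact ⟨rfl, fun _ => rfl⟩

theorem phase4_effect (s : State d) :
    ((phase4 s).1.underBridge =
      if s.underBridge = none ∧ s.canReport then some s.closed else s.underBridge) ∧
    ∀ p, (phase4 s).2 p = if s.underBridge = none ∧ s.canReport then s.reportOut p else none := by
  rw [phase4_eq]
  split_ifs <;> exact ⟨rfl, fun _ => rfl⟩

theorem phase5_effect (s : State d) :
    ((phase5 s).1.comp = if s.comp = none ∧ s.canName then some s.newComp else s.comp) ∧
    ∀ p, (phase5 s).2 p = if s.comp = none ∧ s.canName then s.nameOut p else none := by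
  rw [phase5_eq]
  split_ifs <;> exact ⟨rfl, fun _ => rfl⟩

end PhaseEffects


theorem act_spec (s : State d) : ActSpec s (act s).1 (act s).2 := by
  classical
  obtain ⟨e1, e1', o1⟩ := phase1_effect s
  have f1 := phase1_frame s
  generalize hs1 : (phase1 s).1 = s1 at *
  obtain ⟨e2, o2⟩ := phase2Down_effect s1
  have f2 := phase2Down_frame s1
  generalize hs2 : (phase2Down s1).1 = s2 at *
  obtain ⟨e3, o3⟩ := phase2Up_effect s2
  have f3 := phase2Up_frame s2
  generalize hs3 : (phase2Up s2).1 = s3 at *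
  obtain ⟨e4, o4⟩ := phase3_effect s3
  have f4 := phase3_frame s3
  generalize hs4 : (phase3 s3).1 = s4 at *
  obtain ⟨e5, o5⟩ := phase4_effect s4
  have f5 := phase4_frame s4
  generalize hs5 : (phase4 s4).1 = s5 at *
  obtain ⟨e6, o6⟩ := phase5_effect s5
  have f6 := phase5_frame s5
  generalize hs6 : (phase5 s5).1 = s6 at *
  have hact : act s = (s6, fun p => ((phase1 s).2 p).or (((phase2Down s1).2 p).or
      (((phase2Up s2).2 p).or (((phase3 s3).2 p).or (((phase4 s4).2 p).or ((phase5 s5).2 p)))))) := by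
    simp only [act, andThen, hs1, hs2, hs3, hs4, hs5, hs6]
  rw [hact]
  have j1 : s6.canJoin = s.canJoin := by
    simp only [State.canJoin, State.firstExplorer, f1, f2, f3, f4, f5, f6]
  have j2 : s6.firstExplorer = s.firstExplorer := by
    simp only [State.firstExplorer, f1, f2, f3, f4, f5, f6]
  have j3 : s6.joinOut = s1.joinOut := by
    funext p; simp only [State.joinOut, f2, f3, f4, f5, f6]
  have a1 : s6.canAsk = s1.canAsk := by
    simp only [State.canAsk, State.knowsChildren, State.heardFromParent, f1, f2, f3, f4, f5, f6]
  have a2 : s6.askOut = s1.askOut := by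
    funext p; simp only [State.askOut, State.isChild, f1, f2, f3, f4, f5, f6]
  have c1 : s6.canCount = s2.canCount := by
    simp only [State.canCount, State.childDesc, State.isChild, f1, f2, f3, f4, f5, f6]
  have c2 : s6.newDesc = s2.newDesc := by
    simp only [State.newDesc, State.childDesc, State.isChild, f1, f2, f3, f4, f5, f6]
  have c3 : s6.countOut = s2.countOut := by
    funext p; simp only [State.countOut, c2, f2, f3, f4, f5, f6]
  have l1 : s6.canLabel = s3.canLabel := by
    simp only [State.canLabel, State.heardFromParent, f1, f2, f3, f4, f5, f6]
  have l2 : s6.newLabel = s3.newLabel := by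
    simp only [State.newLabel, State.heardFromParent, f1, f2, f3, f4, f5, f6]
  have l3 : s6.labelOut = s3.labelOut := by
    funext p
    simp only [State.labelOut, State.childDesc, State.isChild, l2, f1, f2, f3, f4, f5, f6]
  have r1 : s6.canReport = s4.canReport := by
    simp only [State.canReport, State.report, f1, f2, f3, f4, f5, f6]
  have r2 : s6.low = s4.low := by
    simp only [State.low, State.pairs, State.report, f1, f2, f3, f4, f5, f6]
  have r3 : s6.high = s4.high := by
    simp only [State.high, State.pairs, State.report, f1, f2, f3, f4, f5, f6]
  have r4 : s6.closed = s4.closed := by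
    simp only [State.closed, r2, r3, f4, f5, f6]
  have r5 : s6.reportOut = s4.reportOut := by
    funext p; simp only [State.reportOut, r2, r3, r4, f5, f6]
  have n1 : s6.canName = s5.canName := by
    simp only [State.canName, State.heardFromParent, f1, f2, f3, f4, f5, f6]
  have n2 : s6.newComp = s5.newComp := by
    simp only [State.newComp, State.heardFromParent, f1, f2, f3, f4, f5, f6]
  have n3 : s6.nameOut = s5.nameOut := by
    funext p; simp only [State.nameOut, n2]
  constructor
  case out =>
    intro p
    simp only [o1, o2, o3, o4, o5, o6, j1, j3, a1, a2, c1, c3, l1, l3, r1, r5, n1, n3, f1, f2, f3,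
      f4, f5]
  all_goals
    simp only [e1, e1', e2, e3, e4, e5, e6, j1, j2, a1, c1, c2, l1, l2, r1, r4, n1, n2, f1, f2, f3,
      f4, f5, f6]

theorem State.Settled.act_eq {s : State d} (h : s.Settled) : act s = (s, fun _ => none) := by
  obtain ⟨h1, h2, h3, h4, h5, h6⟩ := h
  have e1 : phase1 s = (s, fun _ => none) := by
    rw [phase1_eq]; exact if_neg fun h => h.1 (h1 h.2)
  have e2 : phase2Down s = (s, fun _ => none) := by
    rw [phase2Down_eq]; exact if_neg fun h => h.1 (h2 h.2)
  have e3 : phase2Up s = (s, fun _ => none) := by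
    rw [phase2Up_eq]; exact if_neg fun h => by simpa [h.1] using h3 h.2
  have e4 : phase3 s = (s, fun _ => none) := by
    rw [phase3_eq]; exact if_neg fun h => by simpa [h.1] using h4 h.2
  have e5 : phase4 s = (s, fun _ => none) := by
    rw [phase4_eq]; exact if_neg fun h => by simpa [h.1] using h5 h.2
  have e6 : phase5 s = (s, fun _ => none) := by
    rw [phase5_eq]; exact if_neg fun h => by simpa [h.1] using h6 h.2
  simp [act, andThen, e1, e2, e3, e4, e5, e6]

theorem isSome_ite_or {α : Type*} {x : Option α} {c : Prop} [Decidable (x = none ∧ c)] {a : α}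
    (hc : c) : (if x = none ∧ c then some a else x).isSome := by
  cases x <;> simp [hc]

/-- After its actions a node has nothing more to do until the next message arrives. -/
theorem act_settled (s : State d) : (act s).1.Settled := by
  classical
  have h := act_spec s
  refine ⟨fun hc => h.inTree.2 (Or.inr hc), fun hc => h.asked.2 (Or.inr hc), fun hc => ?_,
    fun hc => ?_, fun hc => ?_, fun hc => ?_⟩
  · rw [h.numDesc]; exact isSome_ite_or hc
  · rw [h.preLabel]; exact isSome_ite_or hc
  · rw [h.underBridge]; exact isSome_ite_or hc
  · rw [h.comp]; exact isSome_ite_or hc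

theorem initial_settled (d : ℕ) : (initial d false).Settled := by
  have : (initial d false).firstExplorer = none := by
    simp [State.firstExplorer, initial]
  simp only [State.Settled, State.canJoin, State.canAsk, State.canCount, State.canLabel,
    State.canReport, State.canName, this]
  simp [initial]

theorem start_eq (d : ℕ) (b : Bool) : start d b = act (initial d b) := by
  cases b
  · rw [(initial_settled d).act_eq]; rfl
  · rfl

theorem toNat_isSome_ite {α : Type*} {x : Option α} {c : Prop} [Decidable (x = none ∧ c)] {a : α} :
    (if x = none ∧ c then some a else x).isSome.toNat =
      x.isSome.toNat + if x = none ∧ c then 1 else 0 := by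
  split_ifs with h
  · simp [h.1]
  · simp

theorem toNat_eq_add_ite {a b : Bool} {c : Prop} [Decidable (¬ a = true ∧ c)]
    (h : b = true ↔ a = true ∨ c) : b.toNat = a.toNat + if ¬ a = true ∧ c then 1 else 0 := by
  cases a <;> by_cases hc : c <;> simp_all

/-- A node sends messages only when it performs one of the six local actions for the first time. -/
theorem progress_act (s : State d) : s.progress ≤ (act s).1.progress ∧
    ∀ p, ((act s).2 p).isSome → s.progress < (act s).1.progress := by
  classical
  have h := act_spec s
  set s' := (act s).1
  have hp : s'.progress = s.progress + ((if ¬ s.inTree ∧ s'.canJoin then 1 else 0) +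
      (if ¬ s.asked ∧ s'.canAsk then 1 else 0) + (if s.numDesc = none ∧ s'.canCount then 1 else 0) +
      (if s.preLabel = none ∧ s'.canLabel then 1 else 0) +
      (if s.underBridge = none ∧ s'.canReport then 1 else 0) +
      (if s.comp = none ∧ s'.canName then 1 else 0)) := by
    rw [State.progress, h.numDesc, h.preLabel, h.underBridge, h.comp, toNat_eq_add_ite h.inTree,
      toNat_eq_add_ite h.asked]
    simp only [toNat_isSome_ite, State.progress]
    omega
  refine ⟨by omega, fun p ho => ?_⟩
  rw [h.out p] at ho
  by_contra hlt
  have h0 := Nat.eq_zero_of_not_pos fun hpos => hlt (hp ▸ Nat.lt_add_of_pos_right hpos)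
  simp only [Nat.add_eq_zero_iff, ite_eq_right_iff, one_ne_zero, imp_false] at h0
  obtain ⟨⟨⟨⟨⟨h1, h2⟩, h3⟩, h4⟩, h5⟩, h6⟩ := h0
  rw [if_neg h1, if_neg h2, if_neg h3, if_neg h4, if_neg h5, if_neg h6] at ho
  simp at ho

theorem State.progress_le (s : State d) : s.progress ≤ 6 := by
  have := Bool.toNat_le s.inTree
  have := Bool.toNat_le s.asked
  have := Bool.toNat_le s.numDesc.isSome
  have := Bool.toNat_le s.preLabel.isSome
  have := Bool.toNat_le s.underBridge.isSome
  have := Bool.toNat_le s.comp.isSome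
  unfold State.progress
  omega

/-- The number, from `1` to `6`, of the local action that sends a message: `act` consists of six
actions, as phase 2 has a downcast and a convergecast. -/
def Msg.phase : Msg → ℕ
  | explore | join => 1
  | compute => 2
  | desc _ => 3
  | setLabel _ | cross _ => 4
  | null | markUp _ _ => 5
  | component _ => 6

theorem State.phase_joinOut {s : State d} {p : Fin d} {m : Msg} (h : s.joinOut p = some m) :
    m.phase = 1 := by
  unfold joinOut at h; split_ifs at h <;> cases h <;> rfl

theorem State.phase_askOut {s : State d} {p : Fin d} {m : Msg} (h : s.askOut p = some m) :
    m.phase = 2 := by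
  unfold askOut at h; split_ifs at h; cases h; rfl

theorem State.phase_countOut {s : State d} {p : Fin d} {m : Msg} (h : s.countOut p = some m) :
    m.phase = 3 := by
  unfold countOut at h; split_ifs at h; cases h; rfl

theorem State.phase_labelOut {s : State d} {p : Fin d} {m : Msg} (h : s.labelOut p = some m) :
    m.phase = 4 := by
  unfold labelOut at h; split_ifs at h <;> cases h <;> rfl

theorem State.phase_reportOut {s : State d} {p : Fin d} {m : Msg} (h : s.reportOut p = some m) :
    m.phase = 5 := by
  unfold reportOut at h; split_ifs at h <;> cases h <;> rfl

theorem State.phase_nameOut {s : State d} {p : Fin d} {m : Msg} (h : s.nameOut p = some m) :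
    m.phase = 6 := by
  cases h; rfl

end EdgeBiconnectivity

/-! ### The execution as a sequence of local actions -/

namespace EdgeBiconnectivity

/-- The version of `latch` for the first `n` time steps, for use in inductions on time. -/
theorem latch_of_lt {pre post cond : ℕ → Prop} {τ n : ℕ} (h0 : ¬ pre 0)
    (hs : ∀ t, pre (t + 1) ↔ post t) (hp : ∀ t, post t ↔ pre t ∨ cond t)
    (hc : ∀ t < n, (cond t ↔ τ ≤ t)) :
    ∀ t < n, (post t ↔ τ ≤ t) ∧ (¬ pre t ∧ cond t ↔ t = τ) := by
  intro t
  induction t with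
  | zero =>
    intro ht
    rw [hp, hc 0 ht]
    refine ⟨by simp [h0], by simp only [h0, not_false_eq_true, true_and]; omega⟩
  | succ t ih =>
    intro ht
    have ih := (ih (by omega)).1
    rw [hp, hs, ih, hc _ ht]
    omega

/-- A flag that is set as soon as a condition holds, where the condition holds from time `τ` on. -/
theorem latch {pre post cond : ℕ → Prop} {τ : ℕ} (h0 : ¬ pre 0)
    (hs : ∀ t, pre (t + 1) ↔ post t) (hp : ∀ t, post t ↔ pre t ∨ cond t)
    (hc : ∀ t, cond t ↔ τ ≤ t) (t : ℕ) : (post t ↔ τ ≤ t) ∧ (¬ pre t ∧ cond t ↔ t = τ) :=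
  latch_of_lt h0 hs hp (n := t + 1) (fun s _ => hc s) t (Nat.lt_succ_self t)

open Classical in
/-- A variable that is set as soon as a condition holds, where the condition holds from time `τ`
on. -/
theorem latch_option {α : Type*} {pre post : ℕ → Option α} {val : ℕ → α} {cond : ℕ → Prop} {a : α}
    {τ : ℕ} (h0 : pre 0 = none) (hs : ∀ t, pre (t + 1) = post t)
    (hp : ∀ t, post t = if pre t = none ∧ cond t then some (val t) else pre t)
    (hc : ∀ t, cond t ↔ τ ≤ t) (hv : ∀ t, τ ≤ t → val t = a) (t : ℕ) :
    (post t = if τ ≤ t then some a else none) ∧ (pre t = none ∧ cond t ↔ t = τ) := by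
  have key : ∀ t, pre t = (if τ < t then some a else none) →
      (post t = if τ ≤ t then some a else none) ∧ (pre t = none ∧ cond t ↔ t = τ) := by
    intro t ht
    rw [hp, hc, ht]
    by_cases h1 : τ < t
    · simp [h1, h1.le, h1.ne']
    · by_cases h2 : τ ≤ t
      · obtain rfl : τ = t := by omega
        simp [hv τ le_rfl]
      · simp [h2, h1, show t ≠ τ by omega]
  refine key t ?_
  induction t with
  | zero => simp [h0]
  | succ t ih => rw [hs, (key t ih).1]; simp only [Nat.lt_succ_iff]

open Classical in
theorem findSome?_eq_ite {α β : Type*} {f : α → Option β} {l : List α} {c : Prop} {b : β}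
    (h : ∀ x, (∃ m ∈ l, f m = some x) ↔ c ∧ x = b) :
    l.findSome? f = if c then some b else none := by
  split_ifs with hc
  · obtain ⟨m, hm, hf⟩ := (h b).2 ⟨hc, rfl⟩
    cases hl : l.findSome? f with
    | none => rw [List.findSome?_eq_none_iff] at hl; rw [hl m hm] at hf; cases hf
    | some x =>
      obtain ⟨m', hm', hf'⟩ := List.exists_of_findSome?_eq_some hl
      rw [((h x).1 ⟨m', hm', hf'⟩).2]
  · rw [List.findSome?_eq_none_iff]
    intro m hm
    cases hf : f m with
    | none => rfl
    | some x => exact absurd ((h x).1 ⟨m, hm, hf⟩).1 hc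

section ParentPort

variable {V : Type*} {G : SimpleGraph V} (N : PortNumbering G) (r : V)

/-- The port of `v` to its parent: the first port that leads to a node closer to the root. -/
noncomputable def parentPort (v : V) : Option (Fin (N.deg v)) :=
  (List.finRange (N.deg v)).find? fun p => G.dist r (N.nbr v p) + 1 = G.dist r v

/-- The parent of `v` in the tree built by the algorithm. -/
noncomputable def parentOf (v : V) : Option V := (parentPort N r v).map (N.nbr v)

variable {N r} {v : V} {p : Fin (N.deg v)}

theorem parentPort_eq_some_iff : parentPort N r v = some p ↔ parentOf N r v = some (N.nbr v p) := by
  simp [parentOf]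

theorem isBFSTree_parentOf (hG : G.Connected) : IsBFSTree G r (parentOf N r) := by
  constructor
  · simp [parentOf, parentPort]
  · intro v hv
    obtain ⟨w, hw, hd⟩ : ∃ w, G.Adj v w ∧ G.dist r w + 1 = G.dist r v := by
      obtain ⟨q, hq⟩ := hG.exists_walk_length_eq_dist v r
      cases q with
      | nil => exact absurd rfl hv
      | @cons _ w _ hvw q =>
        refine ⟨w, hvw, ?_⟩
        have h1 := G.dist_le q
        have h2 := hG.dist_triangle (u := v) (v := w) (w := r)
        rw [SimpleGraph.dist_eq_one_iff_adj.2 hvw] at h2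
        rw [SimpleGraph.Walk.length_cons] at hq
        rw [SimpleGraph.dist_comm (u := r) (v := w), SimpleGraph.dist_comm (u := r) (v := v)]
        omega
    obtain ⟨p, rfl⟩ := N.exists_port hw
    have hsome : (parentPort N r v).isSome := by
      rw [parentPort, List.find?_isSome]
      exact ⟨p, List.mem_finRange p, by simpa using hd⟩
    obtain ⟨q, hq⟩ := Option.isSome_iff_exists.1 hsome
    refine ⟨N.nbr v q, parentPort_eq_some_iff.1 hq, N.adj_nbr v q, ?_⟩
    have := List.find?_some hq
    simp only [decide_eq_true_eq] at this
    exact this.symm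

theorem dist_nbr_le (hG : G.Connected) (v : V) (p : Fin (N.deg v)) :
    G.dist r (N.nbr v p) ≤ G.dist r v + 1 := by
  have := hG.dist_triangle (u := r) (v := v) (w := N.nbr v p)
  rwa [SimpleGraph.dist_eq_one_iff_adj.2 (N.adj_nbr v p)] at this

theorem dist_le_nbr (hG : G.Connected) (v : V) (p : Fin (N.deg v)) :
    G.dist r v ≤ G.dist r (N.nbr v p) + 1 := by
  have := dist_nbr_le (r := r) hG (N.nbr v p) (N.back v p)
  rwa [N.nbr_back] at this

end ParentPort

section Execution

variable {V : Type*} [DecidableEq V] {G : SimpleGraph V} (N : PortNumbering G) (r : V)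

/-- The state of node `v` after `t` rounds. -/
def stateAt (t : ℕ) (v : V) : State (N.deg v) := (algorithm.run N r t).state v

/-- The messages that node `v` is about to send after `t` rounds. -/
def outAt (t : ℕ) (v : V) : Outbox (N.deg v) := (algorithm.run N r t).out v

/-- The state of node `v` after the delivery of the messages of round `t`, before it reacts. -/
def before : ℕ → ∀ v, State (N.deg v)
  | 0, v => initial (N.deg v) (decide (v = r))
  | t + 1, v => { stateAt N r t v with
      heard := fun p => (stateAt N r t v).heard p ++ (outAt N r t (N.nbr v p) (N.back v p)).toList }

/-- Nodes that receive nothing stay idle, but they have nothing to do either, so that the execution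
is the same as if all nodes reacted in all rounds. -/
theorem act_before (t : ℕ) (v : V) :
    act (before N r t v) = (stateAt N r t v, outAt N r t v) := by
  induction t with
  | zero => exact (start_eq _ _).symm
  | succ t ih =>
    have hround : (stateAt N r (t + 1) v, outAt N r (t + 1) v) =
        if ∀ p, (outAt N r t (N.nbr v p) (N.back v p)).isNone then
          (stateAt N r t v, fun _ => none)
        else act (before N r (t + 1) v) := rfl
    rw [hround]
    split_ifs with h
    · have hb : before N r (t + 1) v = stateAt N r t v := by
        simp only [Option.isNone_iff_eq_none] at h
        simp [before, h]
      have hs : (stateAt N r t v).Settled := by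
        have := act_settled (before N r t v)
        rwa [ih] at this
      rw [hb, hs.act_eq]
    · rfl

theorem spec (t : ℕ) (v : V) : ActSpec (before N r t v) (stateAt N r t v) (outAt N r t v) := by
  have := act_spec (before N r t v)
  rwa [act_before] at this

theorem leader_stateAt (t : ℕ) (v : V) : (stateAt N r t v).leader = decide (v = r) := by
  induction t with
  | zero => exact (spec N r 0 v).leader
  | succ t ih => exact (spec N r (t + 1) v).leader.trans ih

theorem mem_heard {t : ℕ} {v : V} {p : Fin (N.deg v)} {m : Msg} :
    m ∈ (stateAt N r t v).heard p ↔
      ∃ t' < t, outAt N r t' (N.nbr v p) (N.back v p) = some m := by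
  rw [(spec N r t v).heard]
  induction t with
  | zero => simp [before, initial]
  | succ t ih =>
    have : (before N r (t + 1) v).heard p =
      (stateAt N r t v).heard p ++ (outAt N r t (N.nbr v p) (N.back v p)).toList := rfl
    rw [this, (spec N r t v).heard, List.mem_append, ih, Option.mem_toList]
    constructor
    · rintro (⟨t', ht', h⟩ | h)
      · exact ⟨t', by omega, h⟩
      · exact ⟨t, by omega, h⟩
    · rintro ⟨t', ht', h⟩
      rcases Nat.lt_succ_iff_lt_or_eq.1 ht' with h' | rfl
      · exact Or.inl ⟨t', h', h⟩
      · exact Or.inr h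

open Classical in
/-- What phase 1 contributes to the messages of node `v`. -/
noncomputable def emit1 (t : ℕ) (v : V) (p : Fin (N.deg v)) : Option Msg :=
  if ¬ (before N r t v).inTree ∧ (stateAt N r t v).canJoin then (stateAt N r t v).joinOut p
  else none

open Classical in
/-- What the downcast of phase 2 contributes to the messages of node `v`. -/
noncomputable def emit2 (t : ℕ) (v : V) (p : Fin (N.deg v)) : Option Msg :=
  if ¬ (before N r t v).asked ∧ (stateAt N r t v).canAsk then (stateAt N r t v).askOut p
  else none

open Classical in
/-- What the convergecast of phase 2 contributes to the messages of node `v`. -/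
noncomputable def emit3 (t : ℕ) (v : V) (p : Fin (N.deg v)) : Option Msg :=
  if (before N r t v).numDesc = none ∧ (stateAt N r t v).canCount then
    (stateAt N r t v).countOut p
  else none

open Classical in
/-- What phase 3 contributes to the messages of node `v`. -/
noncomputable def emit4 (t : ℕ) (v : V) (p : Fin (N.deg v)) : Option Msg :=
  if (before N r t v).preLabel = none ∧ (stateAt N r t v).canLabel then
    (stateAt N r t v).labelOut p
  else none

open Classical in
/-- What phase 4 contributes to the messages of node `v`. -/
noncomputable def emit5 (t : ℕ) (v : V) (p : Fin (N.deg v)) : Option Msg :=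
  if (before N r t v).underBridge = none ∧ (stateAt N r t v).canReport then
    (stateAt N r t v).reportOut p
  else none

open Classical in
/-- What phase 5 contributes to the messages of node `v`. -/
noncomputable def emit6 (t : ℕ) (v : V) (p : Fin (N.deg v)) : Option Msg :=
  if (before N r t v).comp = none ∧ (stateAt N r t v).canName then (stateAt N r t v).nameOut p
  else none

variable {N r}

theorem out_eq (t : ℕ) (v : V) (p : Fin (N.deg v)) : outAt N r t v p =
    (emit1 N r t v p).or ((emit2 N r t v p).or ((emit3 N r t v p).or ((emit4 N r t v p).or
      ((emit5 N r t v p).or (emit6 N r t v p))))) :=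
  (spec N r t v).out p

variable {t : ℕ} {v : V} {p : Fin (N.deg v)} {m : Msg}

theorem phase_emit1 (h : emit1 N r t v p = some m) : m.phase = 1 := by
  unfold emit1 at h; split_ifs at h; exact State.phase_joinOut h

theorem phase_emit2 (h : emit2 N r t v p = some m) : m.phase = 2 := by
  unfold emit2 at h; split_ifs at h; exact State.phase_askOut h

theorem phase_emit3 (h : emit3 N r t v p = some m) : m.phase = 3 := by
  unfold emit3 at h; split_ifs at h; exact State.phase_countOut h

theorem phase_emit4 (h : emit4 N r t v p = some m) : m.phase = 4 := by
  unfold emit4 at h; split_ifs at h; exact State.phase_labelOut h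

theorem phase_emit5 (h : emit5 N r t v p = some m) : m.phase = 5 := by
  unfold emit5 at h; split_ifs at h; exact State.phase_reportOut h

theorem phase_emit6 (h : emit6 N r t v p = some m) : m.phase = 6 := by
  unfold emit6 at h; split_ifs at h; exact State.phase_nameOut h

/-- A message is sent if the local action that it belongs to sends it, unless an earlier action uses
the same port at the same time. -/
theorem out_eq_some_iff : outAt N r t v p = some m ↔
    (m.phase = 1 ∧ emit1 N r t v p = some m) ∨
    (m.phase = 2 ∧ emit1 N r t v p = none ∧ emit2 N r t v p = some m) ∨
    (m.phase = 3 ∧ emit1 N r t v p = none ∧ emit2 N r t v p = none ∧ emit3 N r t v p = some m) ∨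
    (m.phase = 4 ∧ emit1 N r t v p = none ∧ emit2 N r t v p = none ∧ emit3 N r t v p = none ∧
      emit4 N r t v p = some m) ∨
    (m.phase = 5 ∧ emit1 N r t v p = none ∧ emit2 N r t v p = none ∧ emit3 N r t v p = none ∧
      emit4 N r t v p = none ∧ emit5 N r t v p = some m) ∨
    (m.phase = 6 ∧ emit1 N r t v p = none ∧ emit2 N r t v p = none ∧ emit3 N r t v p = none ∧
      emit4 N r t v p = none ∧ emit5 N r t v p = none ∧ emit6 N r t v p = some m) := by
  rw [out_eq]
  simp only [Option.or_eq_some_iff]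
  constructor
  · rintro (h | ⟨e1, h | ⟨e2, h | ⟨e3, h | ⟨e4, h | ⟨e5, h⟩⟩⟩⟩⟩)
    · exact .inl ⟨phase_emit1 h, h⟩
    · exact .inr (.inl ⟨phase_emit2 h, e1, h⟩)
    · exact .inr (.inr (.inl ⟨phase_emit3 h, e1, e2, h⟩))
    · exact .inr (.inr (.inr (.inl ⟨phase_emit4 h, e1, e2, e3, h⟩)))
    · exact .inr (.inr (.inr (.inr (.inl ⟨phase_emit5 h, e1, e2, e3, e4, h⟩))))
    · exact .inr (.inr (.inr (.inr (.inr ⟨phase_emit6 h, e1, e2, e3, e4, e5, h⟩))))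
  · rintro (⟨-, h⟩ | ⟨-, e1, h⟩ | ⟨-, e1, e2, h⟩ | ⟨-, e1, e2, e3, h⟩ | ⟨-, e1, e2, e3, e4, h⟩ |
      ⟨-, e1, e2, e3, e4, e5, h⟩)
    · exact .inl h
    · exact .inr ⟨e1, .inl h⟩
    · exact .inr ⟨e1, .inr ⟨e2, .inl h⟩⟩
    · exact .inr ⟨e1, .inr ⟨e2, .inr ⟨e3, .inl h⟩⟩⟩
    · exact .inr ⟨e1, .inr ⟨e2, .inr ⟨e3, .inr ⟨e4, .inl h⟩⟩⟩⟩
    · exact .inr ⟨e1, .inr ⟨e2, .inr ⟨e3, .inr ⟨e4, .inr ⟨e5, h⟩⟩⟩⟩⟩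

/-- Without messages, no state changes. -/
theorem stateAt_succ_of_silent (h : ∀ u p, outAt N r t u p = none) (v : V) :
    stateAt N r (t + 1) v = stateAt N r t v := by
  have hround : stateAt N r (t + 1) v =
      (if ∀ p, (outAt N r t (N.nbr v p) (N.back v p)).isNone then
        (stateAt N r t v, fun _ => none)
      else act (before N r (t + 1) v)).1 := rfl
  rw [hround, if_pos]
  intro p
  rw [h]
  rfl

/-- The progress of a node bounds the number of rounds in which it sends, and it sends at most one
message through each port in a round. -/
theorem sum_card_sent_le (v : V) (T : ℕ) :
    ∑ t ∈ Finset.range T, (Finset.univ.filter fun p => (outAt N r t v p).isSome).card ≤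
      N.deg v * (before N r T v).progress := by
  induction T with
  | zero => simp
  | succ t ih =>
    rw [Finset.sum_range_succ]
    have hnext : (before N r (t + 1) v).progress = (stateAt N r t v).progress := rfl
    obtain ⟨h1, h2⟩ := progress_act (before N r t v)
    rw [act_before] at h1 h2
    rw [hnext]
    by_cases hs : ∃ p, (outAt N r t v p).isSome
    · obtain ⟨p, hp⟩ := hs
      have h3 : (before N r t v).progress + 1 ≤ (stateAt N r t v).progress := h2 p hp
      have h4 : (Finset.univ.filter fun p => (outAt N r t v p).isSome).card ≤ N.deg v :=
        (Finset.card_le_univ _).trans_eq (Fintype.card_fin _)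
      calc _ ≤ N.deg v * (before N r t v).progress + N.deg v := Nat.add_le_add ih h4
        _ = N.deg v * ((before N r t v).progress + 1) := by ring
        _ ≤ _ := Nat.mul_le_mul_left _ h3
    · have h0 : (Finset.univ.filter fun p => (outAt N r t v p).isSome) = ∅ :=
        Finset.filter_eq_empty_iff.2 fun p _ hp => hs ⟨p, hp⟩
      rw [h0, Finset.card_empty, add_zero]
      exact ih.trans (Nat.mul_le_mul_left _ h1)

/-! ### Phase 1: the breadth-first search tree -/

/-- The messages of phase 1 in a round about which it is known whether `v` enters the tree, and with
which parent. -/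
theorem emit1_eq_of_fires
    (hf : ¬ (before N r t v).inTree = true ∧ (stateAt N r t v).canJoin ↔ t = G.dist r v)
    (hp : t = G.dist r v → (stateAt N r t v).parent = parentPort N r v) (p : Fin (N.deg v)) :
    emit1 N r t v p = if t = G.dist r v then
      (if parentOf N r v = some (N.nbr v p) then some Msg.join else some Msg.explore)
    else none := by
  unfold emit1
  by_cases h : t = G.dist r v
  · rw [if_pos (hf.2 h), if_pos h, State.joinOut, hp h]
    simp only [parentPort_eq_some_iff]
  · rw [if_neg (fun h' => h (hf.1 h')), if_neg h]

/-- The `explore` messages spread at one edge per round, so that they reach `v` for the first time in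
round `G.dist r v`, and then from exactly those neighbours that are closer to the root. -/
theorem canJoin_iff_and_firstExplorer (hG : G.Connected) (t : ℕ) :
    ∀ v, ((stateAt N r t v).canJoin ↔ G.dist r v ≤ t) ∧
    (t = G.dist r v → (stateAt N r t v).firstExplorer = parentPort N r v) := by
  induction t using Nat.strong_induction_on with
  | _ t ih =>
    have hT := isBFSTree_parentOf (N := N) (r := r) hG
    have hfire : ∀ t' < t, ∀ u, ¬ (before N r t' u).inTree = true ∧ (stateAt N r t' u).canJoin ↔
        t' = G.dist r u := fun t' ht' u =>
      (latch_of_lt (pre := fun t => (before N r t u).inTree = true)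
        (post := fun t => (stateAt N r t u).inTree = true)
        (by simp [before, initial]) (fun _ => Iff.rfl) (fun t => (spec N r t u).inTree)
        (fun s hs => (ih s hs u).1) t' ht').2
    have hexp : ∀ v p, Msg.explore ∈ (stateAt N r t v).heard p ↔
        G.dist r (N.nbr v p) < t ∧ parentOf N r (N.nbr v p) ≠ some v := by
      intro v p
      rw [mem_heard]
      have : ∀ t' < t, outAt N r t' (N.nbr v p) (N.back v p) = some Msg.explore ↔
          t' = G.dist r (N.nbr v p) ∧ parentOf N r (N.nbr v p) ≠ some v := by
        intro t' ht'
        have hf := hfire t' ht' (N.nbr v p)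
        rw [out_eq_some_iff, emit1_eq_of_fires hf, N.nbr_back]
        · simp [Msg.phase]
        · intro h
          rw [(spec N r t' _).parent, if_pos (hf.2 h), (ih t' ht' _).2 h]
      constructor
      · rintro ⟨t', ht', h⟩
        have h' := (this t' ht').1 h
        exact ⟨h'.1 ▸ ht', h'.2⟩
      · rintro ⟨ht', h⟩
        exact ⟨_, ht', (this _ ht').2 ⟨rfl, h⟩⟩
    intro v
    constructor
    · simp only [State.canJoin, leader_stateAt, decide_eq_true_eq, State.firstExplorer,
        List.find?_isSome, List.mem_finRange, true_and, hexp]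
      constructor
      · rintro (rfl | ⟨p, hp, -⟩)
        · simp
        · have := dist_le_nbr (r := r) hG v p
          omega
      · intro ht
        by_cases hv : v = r
        · exact Or.inl hv
        · obtain ⟨w, hw⟩ := hT.exists_parent hv
          obtain ⟨p, rfl⟩ := N.exists_port (hT.adj hw)
          have hd := hT.dist_eq hw
          refine Or.inr ⟨p, by omega, fun h => ?_⟩
          have := hT.dist_eq h
          omega
    · intro ht
      simp only [State.firstExplorer, parentPort, hexp]
      congr 1
      funext p
      have := dist_le_nbr (r := r) hG v p
      refine decide_eq_decide.2 ⟨fun h => by omega, fun h => ⟨by omega, fun h' => ?_⟩⟩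
      have := hT.dist_eq h'
      omega

theorem fires1_iff (hG : G.Connected) :
    ((stateAt N r t v).inTree = true ↔ G.dist r v ≤ t) ∧
    (¬ (before N r t v).inTree = true ∧ (stateAt N r t v).canJoin ↔ t = G.dist r v) :=
  latch (pre := fun t => (before N r t v).inTree = true)
    (post := fun t => (stateAt N r t v).inTree = true)
    (by simp [before, initial]) (fun _ => Iff.rfl) (fun t => (spec N r t v).inTree)
    (fun s => (canJoin_iff_and_firstExplorer hG s v).1) t

theorem parent_stateAt (hG : G.Connected) (ht : G.dist r v ≤ t) :
    (stateAt N r t v).parent = parentPort N r v := by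
  induction t, ht using Nat.le_induction with
  | base =>
    rw [(spec N r _ v).parent, if_pos ((fires1_iff hG).2.2 rfl),
      (canJoin_iff_and_firstExplorer hG _ v).2 rfl]
  | succ t ht ih =>
    rw [(spec N r _ v).parent, if_neg]
    · exact ih
    · rw [(fires1_iff hG).2]
      omega

theorem emit1_eq (hG : G.Connected) (t : ℕ) (v : V) (p : Fin (N.deg v)) :
    emit1 N r t v p = if t = G.dist r v then
      (if parentOf N r v = some (N.nbr v p) then some Msg.join else some Msg.explore)
    else none :=
  emit1_eq_of_fires (fires1_iff hG).2 (fun h => parent_stateAt hG h.ge) p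

theorem emit1_eq_none (hG : G.Connected) (h : G.dist r v < t) : emit1 N r t v p = none := by
  rw [emit1_eq hG, if_neg h.ne']

theorem isChild_iff (hG : G.Connected) : (stateAt N r t v).isChild p = true ↔
    G.dist r (N.nbr v p) < t ∧ parentOf N r (N.nbr v p) = some v := by
  simp only [State.isChild, decide_eq_true_eq, mem_heard]
  simp only [out_eq_some_iff, Msg.phase, emit1_eq hG, N.nbr_back]
  constructor
  · rintro ⟨t', ht', h⟩
    simp at h
    exact ⟨h.1 ▸ ht', h.2⟩
  · rintro ⟨ht, h⟩
    exact ⟨_, ht, by simp [h]⟩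

theorem explore_mem_heard_iff (hG : G.Connected) : Msg.explore ∈ (stateAt N r t v).heard p ↔
    G.dist r (N.nbr v p) < t ∧ parentOf N r (N.nbr v p) ≠ some v := by
  simp only [mem_heard, out_eq_some_iff, Msg.phase, emit1_eq hG, N.nbr_back]
  constructor
  · rintro ⟨t', ht', h⟩
    simp at h
    exact ⟨h.1 ▸ ht', h.2⟩
  · rintro ⟨ht, h⟩
    exact ⟨_, ht, by simp [h]⟩

end Execution

end EdgeBiconnectivity

/-! ### Time bounds along a tree -/

section SubtreeTime

variable {V : Type*} [Fintype V] (G : SimpleGraph V) (r : V) (par : V → Option V)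

/-- The time at which a convergecast passes node `v`, when every node `u` can take part in it from
time `e u` on and sends its report in the round after the last report of its children. -/
noncomputable def subtreeTime (e : V → ℕ) (v : V) : ℕ :=
  sSup ((fun u => e u + G.dist r u) '' descendants par v) - G.dist r v

variable {G r par} {e : V → ℕ}

/-- The time of a convergecast, characterized by the times of the children. -/
theorem IsBFSTree.subtreeTime_le_iff (h : IsBFSTree G r par) {v : V} {t : ℕ} :
    subtreeTime G r par e v ≤ t ↔
      e v ≤ t ∧ ∀ c, par c = some v → subtreeTime G r par e c < t := by
  set g : V → ℕ := fun u => e u + G.dist r u with hg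
  have hle : ∀ v x, sSup (g '' descendants par v) ≤ x ↔ ∀ u ∈ descendants par v, g u ≤ x := by
    intro v x
    rw [csSup_le_iff ((Set.toFinite _).image g).bddAbove ⟨_, v, mem_descendants_self v, rfl⟩]
    simp
  have hself : ∀ v, g v ≤ sSup (g '' descendants par v) := fun v =>
    (hle v _).1 le_rfl v (mem_descendants_self v)
  have hv := hself v
  simp only [subtreeTime, ← hg]
  have h1 : sSup (g '' descendants par v) - G.dist r v ≤ t ↔
      sSup (g '' descendants par v) ≤ t + G.dist r v := by omega
  rw [h1, hle]
  constructor
  · intro H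
    refine ⟨?_, fun c hc => ?_⟩
    · have := H v (mem_descendants_self v)
      simp only [hg] at this
      omega
    · have h2 := (hle c (t + G.dist r v)).2 fun u hu =>
        H u (mem_descendants_iff_child.2 (Or.inr ⟨c, hc, hu⟩))
      have h3 := hself c
      have h4 := h.dist_eq hc
      simp only [hg] at h2 h3 ⊢
      omega
  · rintro ⟨H1, H2⟩ u hu
    rcases mem_descendants_iff_child.1 hu with rfl | ⟨c, hc, hu⟩
    · simp only [hg]; omega
    · have h2 := (hle c _).1 le_rfl u hu
      have h3 := H2 c hc
      have h4 := h.dist_eq hc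
      omega

theorem IsBFSTree.le_subtreeTime (h : IsBFSTree G r par) (v : V) :
    e v ≤ subtreeTime G r par e v :=
  (h.subtreeTime_le_iff.1 le_rfl).1

theorem IsBFSTree.subtreeTime_child_lt (h : IsBFSTree G r par) {c v : V} (hc : par c = some v) :
    subtreeTime G r par e c < subtreeTime G r par e v :=
  (h.subtreeTime_le_iff.1 le_rfl).2 c hc

theorem IsBFSTree.subtreeTime_add_dist_le (h : IsBFSTree G r par) {b : ℕ}
    (hb : ∀ u, e u + G.dist r u ≤ b) (v : V) : subtreeTime G r par e v + G.dist r v ≤ b := by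
  have := h.le_subtreeTime (e := e) v
  induction v using h.leaf_induction with
  | step v ih =>
    have hb' := hb v
    have : subtreeTime G r par e v ≤ b - G.dist r v := by
      refine h.subtreeTime_le_iff.2 ⟨by omega, fun c hc => ?_⟩
      have h1 := ih c hc (h.le_subtreeTime c)
      have h2 := h.dist_eq hc
      omega
    omega

theorem IsBFSTree.subtreeTime_add_dist_le_root (h : IsBFSTree G r par) (v : V) :
    subtreeTime G r par e v + G.dist r v ≤ subtreeTime G r par e r := by
  induction v using h.root_induction with
  | root => simp
  | step v w hv ih =>
    have h1 := h.subtreeTime_child_lt (e := e) hv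
    have h2 := h.dist_eq hv
    omega

end SubtreeTime

namespace EdgeBiconnectivity

/-! ### The schedule of the algorithm -/

section Schedule

variable {V : Type*} {G : SimpleGraph V} (N : PortNumbering G) (r : V)

/-- `1`, except in the network with a single node, where the algorithm needs no round at all. -/
def delay : ℕ := if N.deg r = 0 then 0 else 1

/-- The time at which node `v` asks its children for their numbers of descendants. -/
noncomputable def askTime (v : V) : ℕ := 2 * delay N r + G.dist r v

/-- The time at which node `v` knows the number of its descendants. -/
noncomputable def countTime (v : V) : ℕ := subtreeTime G r (parentOf N r) (askTime N r) v

/-- The number of descendants of `v`. -/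
noncomputable def numDescendants (v : V) : ℕ := (descendants (parentOf N r) v).ncard

/-- The time at which node `v` gets its preorder label. -/
noncomputable def labelTime (v : V) : ℕ := countTime N r r + G.dist r v

open Classical in
/-- The time from which on node `v` has its label and the labels sent along the non-tree edges. -/
noncomputable def crossTime (v : V) : ℕ :=
  labelTime N r v ⊔ Finset.univ.sup fun p =>
    if parentOf N r v ≠ some (N.nbr v p) ∧ parentOf N r (N.nbr v p) ≠ some v then
      labelTime N r (N.nbr v p) + 1
    else 0

/-- The time at which node `v` knows whether its edge to the parent is a bridge. -/
noncomputable def reportTime (v : V) : ℕ := subtreeTime G r (parentOf N r) (crossTime N r) v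

/-- The time at which node `v` gets its component label. -/
noncomputable def nameTime (v : V) : ℕ := reportTime N r r + G.dist r v

variable {N r} {t : ℕ} {v : V}

theorem crossTime_le_iff : crossTime N r v ≤ t ↔ labelTime N r v ≤ t ∧
    ∀ p, parentOf N r v ≠ some (N.nbr v p) → parentOf N r (N.nbr v p) ≠ some v →
      labelTime N r (N.nbr v p) < t := by
  rw [crossTime, sup_le_iff, Finset.sup_le_iff]
  refine and_congr_right fun _ => forall_congr' fun p => ?_
  simp only [Finset.mem_univ, forall_const]
  split_ifs with h
  · simp [h]
  · simp only [zero_le, true_iff]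
    exact fun h1 h2 => absurd ⟨h1, h2⟩ h

theorem delay_eq_one (hG : G.Connected) (p : Fin (N.deg v)) : delay N r = 1 := by
  have hT := isBFSTree_parentOf (N := N) (r := r) hG
  -- A tree with a node other than the root has a child of the root.
  have key : ∀ x, x ≠ r → N.deg r ≠ 0 := by
    intro x
    induction x using hT.root_induction with
    | root => exact fun h => absurd rfl h
    | step x w hx ih =>
      intro _
      by_cases hw : w = r
      · subst hw
        obtain ⟨q, -⟩ := N.exists_port (hT.adj hx).symm
        have := q.pos
        omega
      · exact ih hw
  refine if_neg ?_
  by_cases hv : v = r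
  · subst hv
    have := p.pos
    omega
  · exact key v hv

theorem askTime_eq (hG : G.Connected) (p : Fin (N.deg v)) : askTime N r v = 2 + G.dist r v := by
  rw [askTime, delay_eq_one hG p]

variable [Fintype V]

variable (N r) in
/-- The preorder label of `v`. -/
noncomputable def treeLabel (v : V) : ℕ := preorderLabel N (parentOf N r) v

theorem countTime_le_iff (hG : G.Connected) : countTime N r v ≤ t ↔
    askTime N r v ≤ t ∧ ∀ c, parentOf N r c = some v → countTime N r c < t :=
  (isBFSTree_parentOf hG).subtreeTime_le_iff

theorem countTime_child_lt (hG : G.Connected) {c : V} (hc : parentOf N r c = some v) :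
    countTime N r c < countTime N r v :=
  (isBFSTree_parentOf hG).subtreeTime_child_lt hc

theorem askTime_le_countTime (hG : G.Connected) (v : V) : askTime N r v ≤ countTime N r v :=
  (isBFSTree_parentOf hG).le_subtreeTime v

theorem dist_le_countTime (hG : G.Connected) (v : V) : G.dist r v ≤ countTime N r v :=
  le_trans (Nat.le_add_left _ _) (askTime_le_countTime hG v)

theorem countTime_le_labelTime (hG : G.Connected) (v : V) :
    countTime N r v + 2 * G.dist r v ≤ labelTime N r v := by
  have := (isBFSTree_parentOf (N := N) (r := r) hG).subtreeTime_add_dist_le_root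
    (e := askTime N r) v
  rw [labelTime, countTime, countTime]
  omega

theorem reportTime_le_iff (hG : G.Connected) : reportTime N r v ≤ t ↔
    crossTime N r v ≤ t ∧ ∀ c, parentOf N r c = some v → reportTime N r c < t :=
  (isBFSTree_parentOf hG).subtreeTime_le_iff

theorem reportTime_child_lt (hG : G.Connected) {c : V} (hc : parentOf N r c = some v) :
    reportTime N r c < reportTime N r v :=
  (isBFSTree_parentOf hG).subtreeTime_child_lt hc

theorem labelTime_le_reportTime (hG : G.Connected) (v : V) :
    labelTime N r v ≤ reportTime N r v :=
  (crossTime_le_iff.1 ((isBFSTree_parentOf hG).le_subtreeTime v)).1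

theorem countTime_le_reportTime (hG : G.Connected) (v : V) :
    countTime N r v ≤ reportTime N r v := by
  have h1 := countTime_le_labelTime (N := N) (r := r) hG v
  have h2 := labelTime_le_reportTime (N := N) (r := r) hG v
  omega

theorem reportTime_le_nameTime (hG : G.Connected) (v : V) :
    reportTime N r v + 2 * G.dist r v ≤ nameTime N r v := by
  have := (isBFSTree_parentOf (N := N) (r := r) hG).subtreeTime_add_dist_le_root
    (e := crossTime N r) v
  rw [nameTime, reportTime, reportTime]
  omega

/-- If there is more than one node, then the reports of phase 4 have to travel at least one edge to the
root, so that phase 5 does not coincide with phase 3 at any node. -/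
theorem labelTime_lt_nameTime (hG : G.Connected) (p : Fin (N.deg v)) :
    labelTime N r v < nameTime N r v := by
  have hT := isBFSTree_parentOf (N := N) (r := r) hG
  -- The root has a child.
  have h0 : N.deg r ≠ 0 := by
    have := delay_eq_one (r := r) hG p
    rw [delay] at this
    split_ifs at this with h
    exact h
  let q : Fin (N.deg r) := ⟨0, Nat.pos_of_ne_zero h0⟩
  have hd : G.dist r (N.nbr r q) = 1 := SimpleGraph.dist_eq_one_iff_adj.2 (N.adj_nbr r q)
  obtain ⟨w, hw⟩ := hT.exists_parent (N.adj_nbr r q).ne'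
  have hr : w = r := by
    have := hT.dist_eq hw
    exact ((hG.dist_eq_zero_iff).1 (show G.dist r w = 0 by omega)).symm
  subst hr
  have h1 := reportTime_child_lt hG hw
  have h2 := labelTime_le_reportTime (N := N) hG (r := w) (N.nbr w q)
  rw [labelTime, hd] at h2
  rw [labelTime, nameTime]
  omega

theorem delay_le_diam (hG : G.Connected) : delay N r ≤ G.diam := by
  have : Nonempty V := ⟨r⟩
  rw [delay]
  split_ifs with h
  · exact Nat.zero_le _
  · let p : Fin (N.deg r) := ⟨0, Nat.pos_of_ne_zero h⟩
    have h1 : G.dist r (N.nbr r p) = 1 := SimpleGraph.dist_eq_one_iff_adj.2 (N.adj_nbr r p)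
    rw [← h1]
    exact SimpleGraph.dist_le_diam (SimpleGraph.connected_iff_ediam_ne_top.1 hG)

theorem nameTime_le (hG : G.Connected) (v : V) :
    nameTime N r v ≤ 5 * G.diam + 3 * delay N r := by
  have hT := isBFSTree_parentOf (N := N) (r := r) hG
  have : Nonempty V := ⟨r⟩
  have hd : ∀ u, G.dist r u ≤ G.diam := fun u =>
    SimpleGraph.dist_le_diam (SimpleGraph.connected_iff_ediam_ne_top.1 hG)
  have h1 : countTime N r r + G.dist r r ≤ 2 * delay N r + 2 * G.diam := by
    refine hT.subtreeTime_add_dist_le (fun u => ?_) r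
    have := hd u
    rw [askTime]
    omega
  have h2 : reportTime N r r + G.dist r r ≤ countTime N r r + 2 * G.diam + delay N r := by
    refine hT.subtreeTime_add_dist_le (fun u => ?_) r
    have hu := hd u
    have : crossTime N r u ≤ countTime N r r + 2 * G.diam + delay N r - G.dist r u := by
      rw [crossTime_le_iff, labelTime]
      refine ⟨by omega, fun p _ _ => ?_⟩
      have h3 := hd (N.nbr u p)
      rw [delay_eq_one hG p, labelTime]
      omega
    omega
  rw [SimpleGraph.dist_self] at h1 h2
  have := hd v
  rw [nameTime]
  omega

end Schedule

section Phases

variable {V : Type*} [DecidableEq V] {G : SimpleGraph V} (N : PortNumbering G) (r : V)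

variable {N r} {t : ℕ} {v : V} {p : Fin (N.deg v)}

theorem heardFromParent_eq (hG : G.Connected) {α : Type} (f : Msg → Option α)
    (ht : G.dist r v ≤ t) (hp : parentOf N r v = some (N.nbr v p)) :
    (stateAt N r t v).heardFromParent f = ((stateAt N r t v).heard p).findSome? f := by
  simp [State.heardFromParent, parent_stateAt hG ht, parentPort_eq_some_iff.2 hp]

theorem parent_eq_some_iff (hG : G.Connected) (ht : G.dist r v ≤ t) :
    (stateAt N r t v).parent = some p ↔ parentOf N r v = some (N.nbr v p) := by
  rw [parent_stateAt hG ht, parentPort_eq_some_iff]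

/-! ### Phase 2: the numbers of descendants -/

theorem knowsChildren_iff (hG : G.Connected) (ht : G.dist r v ≤ t) :
    (stateAt N r t v).knowsChildren = true ↔
      ∀ p, parentOf N r v ≠ some (N.nbr v p) → G.dist r (N.nbr v p) < t := by
  have hj : ∀ p, Msg.join ∈ (stateAt N r t v).heard p ↔
      G.dist r (N.nbr v p) < t ∧ parentOf N r (N.nbr v p) = some v := by
    intro p
    rw [← isChild_iff hG]
    simp [State.isChild]
  simp only [State.knowsChildren, decide_eq_true_eq, hj, explore_mem_heard_iff hG, ne_eq,
    parent_eq_some_iff hG ht]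
  refine forall_congr' fun p => ?_
  tauto

theorem asked_of_canAsk (h : ∀ t, (stateAt N r t v).canAsk ↔ askTime N r v ≤ t) (t : ℕ) :
    ((stateAt N r t v).asked = true ↔ askTime N r v ≤ t) ∧
    (¬ (before N r t v).asked = true ∧ (stateAt N r t v).canAsk ↔ t = askTime N r v) :=
  latch (pre := fun t => (before N r t v).asked = true)
    (post := fun t => (stateAt N r t v).asked = true)
    (by simp [before, initial]) (fun _ => Iff.rfl) (fun t => (spec N r t v).asked) h t

theorem emit2_eq_of_canAsk (hG : G.Connected)
    (h : ∀ t, (stateAt N r t v).canAsk ↔ askTime N r v ≤ t) (t : ℕ) (p : Fin (N.deg v)) :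
    emit2 N r t v p =
      if t = askTime N r v ∧ parentOf N r (N.nbr v p) = some v then some Msg.compute else none := by
  unfold emit2
  by_cases ht : t = askTime N r v
  · have h1 := askTime_eq (r := r) hG p
    have h2 := dist_nbr_le (r := r) hG v p
    rw [if_pos ((asked_of_canAsk h t).2.2 ht), State.askOut]
    simp only [isChild_iff hG, ht, true_and]
    simp only [show G.dist r (N.nbr v p) < askTime N r v by omega, true_and]
  · rw [if_neg fun h' => ht ((asked_of_canAsk h t).2.1 h'), if_neg fun h' => ht h'.1]

/-- When the request of the root arrives, every node has already heard from all its neighbours: the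
request is two rounds behind the `explore` messages. -/
theorem canAsk_iff (hG : G.Connected) (v : V) (t : ℕ) :
    (stateAt N r t v).canAsk ↔ askTime N r v ≤ t := by
  have hT := isBFSTree_parentOf (N := N) (r := r) hG
  induction v using hT.root_induction generalizing t with
  | root =>
    simp only [State.canAsk, leader_stateAt, decide_true, true_or, and_true, (fires1_iff hG).1]
    rw [and_congr_right (knowsChildren_iff hG)]
    simp only [SimpleGraph.dist_self, zero_le, true_and, hT.1, ne_eq, reduceCtorEq,
      not_false_eq_true, forall_const, askTime, delay]
    have hd : ∀ p, G.dist r (N.nbr r p) = 1 := fun p =>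
      SimpleGraph.dist_eq_one_iff_adj.2 (N.adj_nbr r p)
    simp only [hd]
    split_ifs with h0
    · simp only [mul_zero, add_zero, zero_le, iff_true]
      exact fun p => absurd p.pos (by omega)
    · exact ⟨fun h => by have := h ⟨0, by omega⟩; omega, fun h _ => by omega⟩
  | step v w hv ih =>
    obtain ⟨p, rfl⟩ := N.exists_port (hT.adj hv)
    have h1 := askTime_eq (r := r) hG p
    have h2 := askTime_eq (r := r) hG (N.back v p)
    have h3 := hT.dist_eq hv
    have hc : Msg.compute ∈ (stateAt N r t v).heard p ↔ askTime N r (N.nbr v p) < t := by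
      simp only [mem_heard, out_eq_some_iff, Msg.phase, emit2_eq_of_canAsk hG ih, N.nbr_back, hv]
      constructor
      · rintro ⟨t', ht', h⟩
        simp at h
        exact h.2 ▸ ht'
      · intro h
        refine ⟨_, h, ?_⟩
        have := emit1_eq_none (p := N.back v p) hG (show G.dist r (N.nbr v p) <
          askTime N r (N.nbr v p) by omega)
        simp [this]
    by_cases ht : G.dist r v ≤ t
    · have hvr := hT.ne_root hv
      simp only [State.canAsk, leader_stateAt, hvr, decide_false, Bool.false_eq_true, false_or,
        (fires1_iff hG).1, ht, true_and, knowsChildren_iff hG ht, heardFromParent_eq hG _ ht hv,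
        List.findSome?_isSome_iff]
      have : (∃ m ∈ (stateAt N r t v).heard p,
          (if m = Msg.compute then some () else none).isSome = true) ↔
          Msg.compute ∈ (stateAt N r t v).heard p := by
        simp
      rw [this, hc]
      constructor
      · intro h; omega
      · refine fun h => ⟨fun q _ => ?_, by omega⟩
        have := dist_nbr_le (r := r) hG v q
        omega
    · simp only [State.canAsk, (fires1_iff hG).1, ht, false_and, false_iff]
      omega

theorem asked_iff (hG : G.Connected) : (stateAt N r t v).asked = true ↔ askTime N r v ≤ t :=
  (asked_of_canAsk (canAsk_iff hG v) t).1

theorem emit2_eq (hG : G.Connected) (t : ℕ) (v : V) (p : Fin (N.deg v)) :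
    emit2 N r t v p =
      if t = askTime N r v ∧ parentOf N r (N.nbr v p) = some v then some Msg.compute else none :=
  emit2_eq_of_canAsk hG (canAsk_iff hG v) t p

variable (N r) in
/-- Node `v` completes the count of its descendants at the right time with the right result. -/
def CountsCorrectly (v : V) : Prop :=
  (∀ t, (stateAt N r t v).canCount ↔ countTime N r v ≤ t) ∧
    ∀ t, countTime N r v ≤ t → (stateAt N r t v).newDesc = numDescendants N r v

theorem numDesc_of_countsCorrectly
    (h : CountsCorrectly N r v) (t : ℕ) :
    ((stateAt N r t v).numDesc =
      if countTime N r v ≤ t then some (numDescendants N r v) else none) ∧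
    ((before N r t v).numDesc = none ∧ (stateAt N r t v).canCount ↔ t = countTime N r v) := by
  have := latch_option (pre := fun t => (before N r t v).numDesc)
    (post := fun t => (stateAt N r t v).numDesc) rfl (fun _ => rfl)
    (fun t => (spec N r t v).numDesc) h.1 h.2 t
  convert this

variable [Fintype V]

theorem emit3_eq_of_countsCorrectly (hG : G.Connected)
    (h : CountsCorrectly N r v)
    (t : ℕ) (p : Fin (N.deg v)) :
    emit3 N r t v p = if t = countTime N r v ∧ parentOf N r v = some (N.nbr v p) then
      some (Msg.desc (numDescendants N r v)) else none := by
  unfold emit3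
  by_cases ht : t = countTime N r v
  · have hd : G.dist r v ≤ t := ht ▸ dist_le_countTime hG v
    rw [if_pos ((numDesc_of_countsCorrectly h t).2.2 ht), State.countOut, h.2 t ht.ge]
    simp only [parent_eq_some_iff hG hd]
    simp only [ht, true_and]
  · rw [if_neg fun h' => ht ((numDesc_of_countsCorrectly h t).2.1 h'), if_neg fun h' => ht h'.1]

/-- The report of a child is not lost, since the child has entered the tree and asked its own children
before, and it asks none but its children. -/
theorem childDesc_of_countsCorrectly (hG : G.Connected) (hp : parentOf N r (N.nbr v p) = some v)
    (h : CountsCorrectly N r (N.nbr v p)) :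
    (stateAt N r t v).childDesc p =
      if countTime N r (N.nbr v p) < t then some (numDescendants N r (N.nbr v p)) else none := by
  have hT := isBFSTree_parentOf (N := N) (r := r) hG
  have hkey := findSome?_eq_ite (f := Msg.desc?) (l := (stateAt N r t v).heard p)
    (c := countTime N r (N.nbr v p) < t) (b := numDescendants N r (N.nbr v p)) ?_
  · rw [State.childDesc, hkey]
    congr
  · intro x
    have hx : (∃ m ∈ (stateAt N r t v).heard p, Msg.desc? m = some x) ↔
        Msg.desc x ∈ (stateAt N r t v).heard p := by
      constructor
      · rintro ⟨m, hm, h⟩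
        cases m <;> simp [Msg.desc?] at h
        exact h ▸ hm
      · exact fun h => ⟨_, h, rfl⟩
    rw [hx, mem_heard]
    simp only [out_eq_some_iff, Msg.phase, emit3_eq_of_countsCorrectly hG h, emit2_eq hG, N.nbr_back]
    constructor
    · rintro ⟨t', ht', h⟩
      simp at h
      exact ⟨h.2.2.1.1 ▸ ht', h.2.2.2.symm⟩
    · rintro ⟨ht, rfl⟩
      refine ⟨_, ht, ?_⟩
      have h1 := askTime_eq (r := r) hG (N.back v p)
      have h2 := askTime_le_countTime hG (N := N) (r := r) (N.nbr v p)
      have := emit1_eq_none (p := N.back v p) hG (show G.dist r (N.nbr v p) <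
          countTime N r (N.nbr v p) by omega)
      simp [this, hp, hT.parent_asymm hp]

theorem countsCorrectly (hG : G.Connected) (v : V) : CountsCorrectly N r v := by
  have hT := isBFSTree_parentOf (N := N) (r := r) hG
  induction v using hT.leaf_induction with
  | step v ih =>
    have hchild : ∀ {t}, askTime N r v ≤ t → ∀ p, (stateAt N r t v).isChild p = true ↔
        parentOf N r (N.nbr v p) = some v := by
      intro t ht p
      have h1 := askTime_eq (r := r) hG p
      have h2 := dist_nbr_le (r := r) hG v p
      rw [isChild_iff hG, and_iff_right (by omega)]
    constructor
    · intro t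
      rw [countTime_le_iff hG, State.canCount, asked_iff hG]
      refine and_congr_right fun ht => ?_
      constructor
      · intro h c hc
        obtain ⟨p, rfl⟩ := N.exists_port (hT.adj hc).symm
        have := h p ((hchild ht p).2 hc)
        rw [childDesc_of_countsCorrectly hG hc (ih _ hc)] at this
        by_contra hlt
        rw [if_neg hlt] at this
        cases this
      · intro h p hp
        rw [hchild ht] at hp
        rw [childDesc_of_countsCorrectly hG hp (ih _ hp), if_pos (h _ hp)]
        rfl
    · intro t ht
      have ha := (askTime_le_countTime hG v).trans ht
      rw [numDescendants, hT.ncard_descendants N v, State.newDesc]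
      congr 1
      refine Finset.sum_congr ?_ ?_
      · ext p
        simp [hchild ha]
      · intro p hp
        have hp : parentOf N r (N.nbr v p) = some v := by simpa using hp
        rw [childDesc_of_countsCorrectly hG hp (ih _ hp),
          if_pos ((countTime_child_lt hG hp).trans_le ht)]
        rfl

theorem numDesc_stateAt (hG : G.Connected) : (stateAt N r t v).numDesc =
    if countTime N r v ≤ t then some (numDescendants N r v) else none :=
  (numDesc_of_countsCorrectly (countsCorrectly hG v) t).1

theorem emit3_eq (hG : G.Connected) (t : ℕ) (v : V) (p : Fin (N.deg v)) :
    emit3 N r t v p = if t = countTime N r v ∧ parentOf N r v = some (N.nbr v p) then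
      some (Msg.desc (numDescendants N r v)) else none :=
  emit3_eq_of_countsCorrectly hG (countsCorrectly hG v) t p

theorem isChild_of_countTime_le (hG : G.Connected) (ht : countTime N r v ≤ t) :
    (stateAt N r t v).isChild p = true ↔ parentOf N r (N.nbr v p) = some v := by
  have h1 := askTime_eq (r := r) hG p
  have h2 := dist_nbr_le (r := r) hG v p
  have h3 := askTime_le_countTime (N := N) (r := r) hG v
  rw [isChild_iff hG, and_iff_right (by omega)]

/-! ### Phase 3: the preorder labels -/

variable (N r) in
/-- Node `v` takes its preorder label at the right time. -/
def LabelsCorrectly (v : V) : Prop :=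
  (∀ t, (stateAt N r t v).canLabel ↔ labelTime N r v ≤ t) ∧
    ∀ t, labelTime N r v ≤ t → (stateAt N r t v).newLabel = treeLabel N r v

theorem preLabel_of_labelsCorrectly
    (h : LabelsCorrectly N r v) (t : ℕ) :
    ((stateAt N r t v).preLabel =
      if labelTime N r v ≤ t then some (treeLabel N r v) else none) ∧
    ((before N r t v).preLabel = none ∧ (stateAt N r t v).canLabel ↔ t = labelTime N r v) := by
  have := latch_option (pre := fun t => (before N r t v).preLabel)
    (post := fun t => (stateAt N r t v).preLabel) rfl (fun _ => rfl)
    (fun t => (spec N r t v).preLabel) h.1 h.2 t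
  convert this

theorem emit4_eq_of_labelsCorrectly (hG : G.Connected)
    (h : LabelsCorrectly N r v)
    (t : ℕ) (p : Fin (N.deg v)) :
    emit4 N r t v p = if t = labelTime N r v ∧ parentOf N r v ≠ some (N.nbr v p) then
      some (if parentOf N r (N.nbr v p) = some v then Msg.setLabel (treeLabel N r (N.nbr v p))
        else Msg.cross (treeLabel N r v)) else none := by
  have hT := isBFSTree_parentOf (N := N) (r := r) hG
  unfold emit4
  by_cases ht : t = labelTime N r v
  · have hct : countTime N r v ≤ t := by
      have := countTime_le_labelTime (N := N) (r := r) hG v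
      omega
    have hd : G.dist r v ≤ t := (dist_le_countTime hG v).trans hct
    rw [if_pos ((preLabel_of_labelsCorrectly h t).2.2 ht), State.labelOut, h.2 t ht.ge]
    simp only [parent_eq_some_iff hG hd, isChild_of_countTime_le hG hct]
    rw [← ht]
    simp only [true_and, ne_eq]
    by_cases h1 : parentOf N r v = some (N.nbr v p)
    · simp [h1]
    · by_cases h2 : parentOf N r (N.nbr v p) = some v
      · simp only [h1, h2, if_true, if_false, not_false_eq_true]
        rw [treeLabel, treeLabel, hT.preorderLabel_child N h2]
        congr 3
        refine Finset.sum_congr ?_ ?_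
        · ext q
          simp
        · intro q hq
          have hq : parentOf N r (N.nbr v q) = some v := by
            simp only [Finset.mem_filter, Finset.mem_univ, true_and] at hq
            exact hq.2
          rw [childDesc_of_countsCorrectly hG hq (countsCorrectly hG _),
            if_pos ((countTime_child_lt hG hq).trans_le hct)]
          rfl
      · simp [h1, h2]
  · rw [if_neg fun h' => ht ((preLabel_of_labelsCorrectly h t).2.1 h'), if_neg fun h' => ht h'.1]

/-- The label for a child is not lost, since by the time the parent has a label it has sent its
messages of the earlier phases to the child. -/
theorem setLabel_of_labelsCorrectly (hG : G.Connected) (hp : parentOf N r v = some (N.nbr v p))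
    (h : LabelsCorrectly N r (N.nbr v p))
    (ht : G.dist r v ≤ t) :
    (stateAt N r t v).heardFromParent Msg.setLabel? =
      if labelTime N r (N.nbr v p) < t then some (treeLabel N r v) else none := by
  have hT := isBFSTree_parentOf (N := N) (r := r) hG
  rw [heardFromParent_eq hG _ ht hp]
  have hkey := findSome?_eq_ite (f := Msg.setLabel?) (l := (stateAt N r t v).heard p)
    (c := labelTime N r (N.nbr v p) < t) (b := treeLabel N r v) ?_
  · rw [hkey]
    congr
  · intro x
    have hx : (∃ m ∈ (stateAt N r t v).heard p, Msg.setLabel? m = some x) ↔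
        Msg.setLabel x ∈ (stateAt N r t v).heard p := by
      constructor
      · rintro ⟨m, hm, h⟩
        cases m <;> simp [Msg.setLabel?] at h
        exact h ▸ hm
      · exact fun h => ⟨_, h, rfl⟩
    rw [hx, mem_heard]
    simp only [out_eq_some_iff, Msg.phase, emit4_eq_of_labelsCorrectly hG h, emit3_eq hG, emit2_eq hG,
      N.nbr_back]
    constructor
    · rintro ⟨t', ht', h⟩
      simp [hp] at h
      exact ⟨h.2.2.2.1.1 ▸ ht', h.2.2.2.2.symm⟩
    · rintro ⟨ht, rfl⟩
      refine ⟨_, ht, ?_⟩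
      have h1 := askTime_eq (r := r) hG (N.back v p)
      have h2 := askTime_le_countTime hG (N := N) (r := r) v
      have h3 := askTime_eq (r := r) hG p
      have h4 := hT.dist_eq hp
      have h5 : countTime N r v < countTime N r (N.nbr v p) := countTime_child_lt hG hp
      have h6 := countTime_le_labelTime hG (N := N) (r := r) (N.nbr v p)
      have := emit1_eq_none (p := N.back v p) hG (show G.dist r (N.nbr v p) <
          labelTime N r (N.nbr v p) by omega)
      simp [this, hp, hT.parent_asymm hp]
      omega

theorem labelsCorrectly (hG : G.Connected) (v : V) : LabelsCorrectly N r v := by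
  have hT := isBFSTree_parentOf (N := N) (r := r) hG
  have hnum : ∀ v t, (stateAt N r t v).numDesc.isSome = true ↔ countTime N r v ≤ t := by
    intro v t
    rw [numDesc_stateAt hG]
    split_ifs with h <;> simp [h]
  induction v using hT.root_induction with
  | root =>
    simp only [LabelsCorrectly, State.canLabel, State.newLabel, leader_stateAt, decide_true,
      true_or, and_true, hnum,
      if_true, treeLabel, hT.preorderLabel_root, labelTime, SimpleGraph.dist_self, add_zero,
      implies_true, and_self]
  | step v w hv ih =>
    obtain ⟨p, rfl⟩ := N.exists_port (hT.adj hv)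
    have hvr := hT.ne_root hv
    have h1 := countTime_le_labelTime hG (N := N) (r := r) v
    have h2 := hT.dist_eq hv
    have h3 := dist_le_countTime (N := N) hG (r := r) v
    have h4 : labelTime N r v = labelTime N r (N.nbr v p) + 1 := by
      simp only [labelTime]
      omega
    constructor
    · intro t
      simp only [State.canLabel, leader_stateAt, hvr, decide_false, Bool.false_eq_true, false_or,
        hnum]
      by_cases ht : countTime N r v ≤ t
      · rw [setLabel_of_labelsCorrectly hG hv ih (h3.trans ht)]
        split_ifs with h <;> simp <;> omega
      · simp only [ht, false_and, false_iff]
        omega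
    · intro t ht
      simp only [State.newLabel, leader_stateAt, hvr, decide_false, Bool.false_eq_true, if_false]
      rw [setLabel_of_labelsCorrectly hG hv ih (by omega), if_pos (by omega)]
      rfl

theorem preLabel_stateAt (hG : G.Connected) : (stateAt N r t v).preLabel =
    if labelTime N r v ≤ t then some (treeLabel N r v) else none :=
  (preLabel_of_labelsCorrectly (labelsCorrectly hG v) t).1

theorem emit4_eq (hG : G.Connected) (t : ℕ) (v : V) (p : Fin (N.deg v)) :
    emit4 N r t v p = if t = labelTime N r v ∧ parentOf N r v ≠ some (N.nbr v p) then
      some (if parentOf N r (N.nbr v p) = some v then Msg.setLabel (treeLabel N r (N.nbr v p))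
        else Msg.cross (treeLabel N r v)) else none :=
  emit4_eq_of_labelsCorrectly hG (labelsCorrectly hG v) t p

end Phases

theorem foldl_min_isLeast (l : List ℕ) (k : ℕ) : IsLeast {x | x = k ∨ x ∈ l} (l.foldl min k) := by
  induction l generalizing k with
  | nil => exact ⟨Or.inl rfl, fun x hx => by simp at hx; simp [hx]⟩
  | cons a l ih =>
    obtain ⟨h1, h2⟩ := ih (min k a)
    rw [List.foldl_cons]
    constructor
    · rcases h1 with h1 | h1
      · rcases min_choice k a with h | h
        · exact Or.inl (h1.trans h)
        · exact Or.inr (List.mem_cons.2 (Or.inl (h1.trans h)))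
      · exact Or.inr (List.mem_cons_of_mem _ h1)
    · rintro x (rfl | hx)
      · exact (h2 (Or.inl rfl)).trans (min_le_left _ _)
      · rcases List.mem_cons.1 hx with rfl | hx
        · exact (h2 (Or.inl rfl)).trans (min_le_right _ _)
        · exact h2 (Or.inr hx)

theorem foldl_max_isGreatest (l : List ℕ) (k : ℕ) :
    IsGreatest {x | x = k ∨ x ∈ l} (l.foldl max k) := by
  induction l generalizing k with
  | nil => exact ⟨Or.inl rfl, fun x hx => by simp at hx; simp [hx]⟩
  | cons a l ih =>
    obtain ⟨h1, h2⟩ := ih (max k a)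
    rw [List.foldl_cons]
    constructor
    · rcases h1 with h1 | h1
      · rcases max_choice k a with h | h
        · exact Or.inl (h1.trans h)
        · exact Or.inr (List.mem_cons.2 (Or.inl (h1.trans h)))
      · exact Or.inr (List.mem_cons_of_mem _ h1)
    · rintro x (rfl | hx)
      · exact (le_max_left _ _).trans (h2 (Or.inl rfl))
      · rcases List.mem_cons.1 hx with rfl | hx
        · exact (le_max_right _ _).trans (h2 (Or.inl rfl))
        · exact h2 (Or.inr hx)

section Phases

variable {V : Type*} [Fintype V] [DecidableEq V] {G : SimpleGraph V} (N : PortNumbering G) (r : V)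

/-! ### Phase 4: the cycle edges -/

variable {N r} {t : ℕ} {v : V} {p : Fin (N.deg v)}

theorem numDesc_isSome (hG : G.Connected) :
    (stateAt N r t v).numDesc.isSome = true ↔ countTime N r v ≤ t := by
  rw [numDesc_stateAt hG]
  split_ifs with h <;> simp [h]

theorem preLabel_isSome (hG : G.Connected) :
    (stateAt N r t v).preLabel.isSome = true ↔ labelTime N r v ≤ t := by
  rw [preLabel_stateAt hG]
  split_ifs with h <;> simp [h]

variable (N r) in
/-- The outcome of phase 4 at node `v`. -/
def ReportsCorrectly (v : V) : Prop :=
  (∀ t, (stateAt N r t v).canReport ↔ reportTime N r v ≤ t) ∧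
    ∀ t, reportTime N r v ≤ t →
      (stateAt N r t v).low = lowLabel N (parentOf N r) v ∧
      (stateAt N r t v).high = highLabel N (parentOf N r) v ∧
      ((stateAt N r t v).closed = true ↔ exits G (parentOf N r) v = ∅)

open Classical in
variable (N r) in
/-- The pair that node `v` reports to its parent in phase 4, if any. -/
noncomputable def reportPair (v : V) : Option (ℕ × ℕ) :=
  if exits G (parentOf N r) v = ∅ then none
  else some (lowLabel N (parentOf N r) v, highLabel N (parentOf N r) v)

/-- Phase 4 message that stands for a report. -/
def pairMsg : Option (ℕ × ℕ) → Msg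
  | none => Msg.null
  | some (u, v) => Msg.markUp u v

open Classical in
theorem underBridge_of_reportsCorrectly (h : ReportsCorrectly N r v) (t : ℕ) :
    ((stateAt N r t v).underBridge =
      if reportTime N r v ≤ t then some (decide (exits G (parentOf N r) v = ∅)) else none) ∧
    ((before N r t v).underBridge = none ∧ (stateAt N r t v).canReport ↔
      t = reportTime N r v) := by
  have := latch_option (pre := fun t => (before N r t v).underBridge)
    (post := fun t => (stateAt N r t v).underBridge) (a := decide (exits G (parentOf N r) v = ∅))
    rfl (fun _ => rfl) (fun t => (spec N r t v).underBridge) h.1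
    (fun t ht => Bool.eq_iff_iff.2 (by rw [(h.2 t ht).2.2, decide_eq_true_eq])) t
  convert this

/-- Reports are sent to the parent only. -/
theorem emit5_eq_none (hG : G.Connected) (hp : parentOf N r v ≠ some (N.nbr v p)) :
    emit5 N r t v p = none := by
  unfold emit5
  split_ifs with h
  · have hd := (dist_le_countTime hG v).trans ((numDesc_isSome hG).1 h.2.1)
    rw [State.reportOut, if_neg (by rwa [parent_eq_some_iff hG hd])]
  · rfl

theorem emit5_eq_of_reportsCorrectly (hG : G.Connected) (h : ReportsCorrectly N r v)
    (t : ℕ) (p : Fin (N.deg v)) :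
    emit5 N r t v p = if t = reportTime N r v ∧ parentOf N r v = some (N.nbr v p) then
      some (pairMsg (reportPair N r v)) else none := by
  unfold emit5
  by_cases ht : t = reportTime N r v
  · have hd : G.dist r v ≤ t :=
      (dist_le_countTime hG v).trans (ht ▸ countTime_le_reportTime hG v)
    obtain ⟨h1, h2, h3⟩ := h.2 t ht.ge
    rw [if_pos ((underBridge_of_reportsCorrectly h t).2.2 ht), State.reportOut, h1, h2]
    simp only [parent_eq_some_iff hG hd, h3, reportPair]
    simp only [ht, true_and]
    split_ifs <;> rfl
  · rw [if_neg fun h' => ht ((underBridge_of_reportsCorrectly h t).2.1 h'),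
      if_neg fun h' => ht h'.1]

theorem emit1_eq_none_of_labelTime_le (hG : G.Connected) (ht : labelTime N r v ≤ t) :
    emit1 N r t v p = none := by
  have h1 := askTime_eq (r := r) hG p
  have h2 := askTime_le_countTime (N := N) (r := r) hG v
  have h3 := countTime_le_labelTime (N := N) (r := r) hG v
  exact emit1_eq_none hG (by omega)

/-- Through a non-tree edge, a node hears exactly the preorder label of the other end. -/
theorem report_cross (hG : G.Connected) (hp : parentOf N r v ≠ some (N.nbr v p))
    (hp' : parentOf N r (N.nbr v p) ≠ some v) :
    (stateAt N r t v).report p = if labelTime N r (N.nbr v p) < t then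
      some (some (treeLabel N r (N.nbr v p), treeLabel N r (N.nbr v p))) else none := by
  have hkey := findSome?_eq_ite (f := Msg.report?) (l := (stateAt N r t v).heard p)
    (c := labelTime N r (N.nbr v p) < t)
    (b := some (treeLabel N r (N.nbr v p), treeLabel N r (N.nbr v p))) ?_
  · rw [State.report, hkey]
    congr
  · intro x
    simp only [mem_heard]
    have h5 : ∀ t', emit5 N r t' (N.nbr v p) (N.back v p) = none := fun t' =>
      emit5_eq_none hG (by rwa [N.nbr_back])
    constructor
    · rintro ⟨m, ⟨t', ht', h⟩, hm⟩
      rw [out_eq_some_iff, h5, emit4_eq hG, N.nbr_back] at h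
      cases m <;> simp [Msg.report?] at hm <;> simp [Msg.phase, hp, hp'] at h
      obtain ⟨-, -, -, rfl, rfl⟩ := h
      exact ⟨ht', hm.symm⟩
    · rintro ⟨ht, rfl⟩
      refine ⟨Msg.cross (treeLabel N r (N.nbr v p)), ⟨_, ht, ?_⟩, rfl⟩
      rw [out_eq_some_iff, emit1_eq_none_of_labelTime_le hG le_rfl, emit2_eq hG, emit3_eq hG,
        emit4_eq hG, N.nbr_back]
      simp [Msg.phase, hp, hp']

/-- Along a tree edge, a node hears the report of its child. -/
theorem report_child (hG : G.Connected) (hp : parentOf N r (N.nbr v p) = some v)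
    (h : ReportsCorrectly N r (N.nbr v p)) :
    (stateAt N r t v).report p = if reportTime N r (N.nbr v p) < t then
      some (reportPair N r (N.nbr v p)) else none := by
  have hT := isBFSTree_parentOf (N := N) (r := r) hG
  have hkey := findSome?_eq_ite (f := Msg.report?) (l := (stateAt N r t v).heard p)
    (c := reportTime N r (N.nbr v p) < t) (b := reportPair N r (N.nbr v p)) ?_
  · rw [State.report, hkey]
    congr
  · intro x
    simp only [mem_heard]
    constructor
    · rintro ⟨m, ⟨t', ht', h'⟩, hm⟩
      rw [out_eq_some_iff, emit4_eq hG, emit5_eq_of_reportsCorrectly hG h, N.nbr_back] at h'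
      cases hr : reportPair N r (N.nbr v p) <;>
        cases m <;> simp [Msg.report?] at hm <;> simp [Msg.phase, hp, hr, pairMsg] at h'
      · exact ⟨h'.2.2.2 ▸ ht', hm.symm⟩
      · obtain ⟨-, -, -, h1, h2, h3⟩ := h'
        exact ⟨h1 ▸ ht', by rw [← hm, ← h2, ← h3]⟩
    · rintro ⟨ht, rfl⟩
      refine ⟨pairMsg (reportPair N r (N.nbr v p)), ⟨_, ht, ?_⟩, ?_⟩
      · have h1 := labelTime_le_reportTime (N := N) (r := r) hG (N.nbr v p)
        have h2 := countTime_le_labelTime (N := N) (r := r) hG (N.nbr v p)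
        have h3 := hT.dist_eq hp
        have hph : (pairMsg (reportPair N r (N.nbr v p))).phase = 5 := by
          cases reportPair N r (N.nbr v p) <;> rfl
        rw [out_eq_some_iff, emit1_eq_none_of_labelTime_le hG h1, emit2_eq hG, emit3_eq hG,
          emit4_eq hG, emit5_eq_of_reportsCorrectly hG h, N.nbr_back, hph]
        simp [hp, hT.parent_asymm hp]
        omega
      · cases reportPair N r (N.nbr v p) <;> rfl

theorem mem_pairs {d : ℕ} {s : State d} {x : ℕ × ℕ} :
    x ∈ s.pairs ↔ ∃ p, s.parent ≠ some p ∧ s.report p = some (some x) := by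
  simp only [State.pairs, List.mem_filterMap, List.mem_finRange, true_and]
  refine exists_congr fun p => ?_
  split_ifs with h
  · simp [h]
  · simp [h, Option.join_eq_some_iff]

theorem reportsCorrectly (hG : G.Connected) (v : V) : ReportsCorrectly N r v := by
  have hT := isBFSTree_parentOf (N := N) (r := r) hG
  induction v using hT.leaf_induction with
  | step v ih =>
    have hrep : ∀ t p, parentOf N r v ≠ some (N.nbr v p) →
        (((stateAt N r t v).report p).isSome ↔
          if parentOf N r (N.nbr v p) = some v then reportTime N r (N.nbr v p) < t
          else labelTime N r (N.nbr v p) < t) := by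
      intro t p hp
      split_ifs with hc
      · rw [report_child hG hc (ih _ hc)]
        split_ifs with h <;> simp [h]
      · rw [report_cross hG hp hc]
        split_ifs with h <;> simp [h]
    have hcan : ∀ t, (stateAt N r t v).canReport ↔ reportTime N r v ≤ t := by
      intro t
      rw [reportTime_le_iff hG, crossTime_le_iff, State.canReport, numDesc_isSome hG,
        preLabel_isSome hG]
      have h1 := countTime_le_labelTime (N := N) (r := r) hG v
      have h2 := dist_le_countTime (N := N) (r := r) hG v
      constructor
      · rintro ⟨-, hl, h⟩
        have hd : G.dist r v ≤ t := by omega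
        simp only [ne_eq, parent_eq_some_iff hG hd] at h
        refine ⟨⟨hl, fun p hp hc => ?_⟩, fun c hc => ?_⟩
        · have := (hrep t p hp).1 (h p hp)
          rwa [if_neg hc] at this
        · obtain ⟨p, rfl⟩ := N.exists_port (hT.adj hc).symm
          have hp := hT.parent_asymm hc
          have := (hrep t p hp).1 (h p hp)
          rwa [if_pos hc] at this
      · rintro ⟨⟨hl, h⟩, h'⟩
        have hd : G.dist r v ≤ t := by omega
        refine ⟨by omega, hl, fun p hp => ?_⟩
        rw [ne_eq, parent_eq_some_iff hG hd] at hp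
        rw [hrep t p hp]
        split_ifs with hc
        · exact h' _ hc
        · exact h p hp hc
    refine ⟨hcan, fun t ht => ?_⟩
    have hlt : labelTime N r v ≤ t := (labelTime_le_reportTime hG v).trans ht
    have hct : countTime N r v ≤ t := (countTime_le_reportTime hG v).trans ht
    have hd : G.dist r v ≤ t := (dist_le_countTime hG v).trans hct
    have hk : (stateAt N r t v).preLabel.getD 0 = treeLabel N r v := by
      rw [preLabel_stateAt hG, if_pos hlt, Option.getD_some]
    have hn : (stateAt N r t v).numDesc.getD 0 = numDescendants N r v := by
      rw [numDesc_stateAt hG, if_pos hct, Option.getD_some]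
    have hpairs : ∀ x, x ∈ (stateAt N r t v).pairs ↔ ∃ p, parentOf N r v ≠ some (N.nbr v p) ∧
        if parentOf N r (N.nbr v p) = some v then reportPair N r (N.nbr v p) = some x
        else x = (treeLabel N r (N.nbr v p), treeLabel N r (N.nbr v p)) := by
      intro x
      obtain ⟨h1, h2⟩ := (reportTime_le_iff hG).1 ht
      rw [crossTime_le_iff] at h1
      rw [mem_pairs]
      simp only [ne_eq, parent_eq_some_iff hG hd]
      refine exists_congr fun p => and_congr_right fun hp => ?_
      split_ifs with hc
      · rw [report_child hG hc (ih _ hc), if_pos (h2 _ hc), Option.some.injEq]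
      · rw [report_cross hG hp hc, if_pos (h1.2 p hp hc), Option.some.injEq, Option.some.injEq,
          eq_comm]
    -- All entries of the pairs are labels that `v` has to take into account.
    have hmem : ∀ x ∈ (stateAt N r t v).pairs, x.1 ∈ reachedLabels N (parentOf N r) v ∧
        x.2 ∈ reachedLabels N (parentOf N r) v := by
      intro x hx
      obtain ⟨p, hp, hx⟩ := (hpairs x).1 hx
      split_ifs at hx with hc
      · rw [reportPair] at hx
        split_ifs at hx with he
        obtain rfl := Option.some.inj hx
        have hs := hT.reachedLabels_child_subset N hc
        exact ⟨hs (isLeast_lowLabel N _).1, hs (isGreatest_highLabel N _).1⟩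
      · subst hx
        have := cross_mem_reachedLabels N (N.adj_nbr v p) hp
        exact ⟨this, this⟩
    -- Conversely, every such label lies in the interval of `v` or between the entries of a pair.
    have hcover : ∀ y ∈ reachedLabels N (parentOf N r) v,
        (treeLabel N r v ≤ y ∧ y < treeLabel N r v + numDescendants N r v) ∨
          ∃ x ∈ (stateAt N r t v).pairs, x.1 ≤ y ∧ y ≤ x.2 := by
      rintro _ ⟨z, hz | hz, rfl⟩
      · exact Or.inl ((hT.mem_descendants_iff_label N).1 hz)
      · rcases exits_cases hz with ⟨hvz, h1, h2⟩ | ⟨c, hc, hz⟩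
        · obtain ⟨p, rfl⟩ := N.exists_port hvz
          exact Or.inr ⟨_, (hpairs _).2 ⟨p, h1, by rw [if_neg h2]⟩, le_rfl, le_rfl⟩
        · obtain ⟨p, rfl⟩ := N.exists_port (hT.adj hc).symm
          have hy : preorderLabel N (parentOf N r) z ∈ reachedLabels N (parentOf N r) (N.nbr v p) :=
            ⟨z, Or.inr hz, rfl⟩
          refine Or.inr ⟨(lowLabel N (parentOf N r) (N.nbr v p),
            highLabel N (parentOf N r) (N.nbr v p)), (hpairs _).2 ⟨p, hT.parent_asymm hc, ?_⟩,
            (isLeast_lowLabel N _).2 hy, (isGreatest_highLabel N _).2 hy⟩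
          rw [if_pos hc, reportPair, if_neg (Set.nonempty_iff_ne_empty.1 ⟨z, hz⟩)]
    have hlow : (stateAt N r t v).low = lowLabel N (parentOf N r) v := by
      have hL := foldl_min_isLeast ((stateAt N r t v).pairs.map Prod.fst) (treeLabel N r v)
      rw [State.low, hk]
      refine IsLeast.unique ⟨?_, fun y hy => ?_⟩ (isLeast_lowLabel N v)
      · rcases hL.1 with h | h
        · rw [h]; exact label_mem_reachedLabels N v
        · obtain ⟨x, hx, h⟩ := List.mem_map.1 h
          rw [← h]; exact (hmem x hx).1
      · rcases hcover y hy with h | ⟨x, hx, h, -⟩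
        · exact (hL.2 (Or.inl rfl)).trans h.1
        · exact (hL.2 (Or.inr (List.mem_map.2 ⟨x, hx, rfl⟩))).trans h
    have hhigh : (stateAt N r t v).high = highLabel N (parentOf N r) v := by
      have hL := foldl_max_isGreatest ((stateAt N r t v).pairs.map Prod.snd)
        (treeLabel N r v + numDescendants N r v - 1)
      rw [State.high, hk, hn]
      refine IsGreatest.unique ⟨?_, fun y hy => ?_⟩ (isGreatest_highLabel N v)
      · rcases hL.1 with h | h
        · rw [h]
          have hpos : 0 < numDescendants N r v := ncard_descendants_pos v
          have : treeLabel N r v + numDescendants N r v - 1 ∈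
              preorderLabel N (parentOf N r) '' descendants (parentOf N r) v := by
            rw [hT.image_preorderLabel N v]
            change _ ∈ Set.Ico (treeLabel N r v) (treeLabel N r v + numDescendants N r v)
            rw [Set.mem_Ico]
            omega
          exact Set.image_mono Set.subset_union_left this
        · obtain ⟨x, hx, h⟩ := List.mem_map.1 h
          rw [← h]; exact (hmem x hx).2
      · rcases hcover y hy with h | ⟨x, hx, -, h⟩
        · exact le_trans (by omega) (hL.2 (Or.inl rfl))
        · exact h.trans (hL.2 (Or.inr (List.mem_map.2 ⟨x, hx, rfl⟩)))
    refine ⟨hlow, hhigh, ?_⟩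
    rw [State.closed, hlow, hhigh, hk, hn, decide_eq_true_eq]
    exact (hT.exits_eq_empty_iff_label N v).symm

open Classical in
theorem underBridge_stateAt (hG : G.Connected) : (stateAt N r t v).underBridge =
    if reportTime N r v ≤ t then some (decide (exits G (parentOf N r) v = ∅)) else none :=
  (underBridge_of_reportsCorrectly (reportsCorrectly hG v) t).1

theorem emit5_eq (hG : G.Connected) (t : ℕ) (v : V) (p : Fin (N.deg v)) :
    emit5 N r t v p = if t = reportTime N r v ∧ parentOf N r v = some (N.nbr v p) then
      some (pairMsg (reportPair N r v)) else none :=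
  emit5_eq_of_reportsCorrectly hG (reportsCorrectly hG v) t p

/-! ### Phase 5: the component labels -/

variable (N r) in
/-- The outcome of phase 5 at node `v`. -/
def NamesCorrectly (v : V) : Prop :=
  (∀ t, (stateAt N r t v).canName ↔ nameTime N r v ≤ t) ∧
    ∀ t, nameTime N r v ≤ t → (stateAt N r t v).newComp = componentLabel N (parentOf N r) v

theorem comp_of_namesCorrectly (h : NamesCorrectly N r v) (t : ℕ) :
    ((stateAt N r t v).comp =
      if nameTime N r v ≤ t then some (componentLabel N (parentOf N r) v) else none) ∧
    ((before N r t v).comp = none ∧ (stateAt N r t v).canName ↔ t = nameTime N r v) := by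
  have := latch_option (pre := fun t => (before N r t v).comp)
    (post := fun t => (stateAt N r t v).comp) rfl (fun _ => rfl)
    (fun t => (spec N r t v).comp) h.1 h.2 t
  convert this

theorem emit6_eq_of_namesCorrectly (h : NamesCorrectly N r v)
    (t : ℕ) (p : Fin (N.deg v)) :
    emit6 N r t v p = if t = nameTime N r v then
      some (Msg.component (componentLabel N (parentOf N r) v)) else none := by
  unfold emit6
  by_cases ht : t = nameTime N r v
  · rw [if_pos ((comp_of_namesCorrectly h t).2.2 ht), if_pos ht, State.nameOut, h.2 t ht.ge]
  · rw [if_neg fun h' => ht ((comp_of_namesCorrectly h t).2.1 h'), if_neg ht]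

/-- No other phase is active at a node when it sends its component label. -/
theorem emit_eq_none_at_nameTime (hG : G.Connected) (p : Fin (N.deg v)) :
    emit1 N r (nameTime N r v) v p = none ∧ emit2 N r (nameTime N r v) v p = none ∧
    emit3 N r (nameTime N r v) v p = none ∧ emit4 N r (nameTime N r v) v p = none ∧
    emit5 N r (nameTime N r v) v p = none := by
  have h2 := askTime_le_countTime hG (N := N) (r := r) v
  have h3 := countTime_le_labelTime hG (N := N) (r := r) v
  have h4 := labelTime_lt_nameTime hG (r := r) p
  have h5 := reportTime_le_nameTime hG (N := N) (r := r) v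
  refine ⟨emit1_eq_none_of_labelTime_le hG h4.le, ?_, ?_, ?_, ?_⟩
  · rw [emit2_eq hG, if_neg (fun h => by omega)]
  · rw [emit3_eq hG, if_neg (fun h => by omega)]
  · rw [emit4_eq hG, if_neg (fun h => by omega)]
  · rw [emit5_eq hG, if_neg]
    rintro ⟨h, hp⟩
    have := (isBFSTree_parentOf hG).dist_eq hp
    omega

/-- Component labels are not lost, whichever port they are sent through. -/
theorem nbrComp_of_namesCorrectly (hG : G.Connected) (h : NamesCorrectly N r (N.nbr v p)) :
    (stateAt N r t v).nbrComp p = if nameTime N r (N.nbr v p) < t then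
      some (componentLabel N (parentOf N r) (N.nbr v p)) else none := by
  have hT := isBFSTree_parentOf (N := N) (r := r) hG
  have hkey := findSome?_eq_ite (f := Msg.component?) (l := (stateAt N r t v).heard p)
    (c := nameTime N r (N.nbr v p) < t) (b := componentLabel N (parentOf N r) (N.nbr v p)) ?_
  · rw [State.nbrComp, hkey]
    congr
  · intro x
    have hx : (∃ m ∈ (stateAt N r t v).heard p, Msg.component? m = some x) ↔
        Msg.component x ∈ (stateAt N r t v).heard p := by
      constructor
      · rintro ⟨m, hm, h⟩
        cases m <;> simp [Msg.component?] at h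
        exact h ▸ hm
      · exact fun h => ⟨_, h, rfl⟩
    rw [hx, mem_heard]
    simp only [out_eq_some_iff, Msg.phase, emit6_eq_of_namesCorrectly h]
    constructor
    · rintro ⟨t', ht', h⟩
      simp at h
      exact ⟨h.2.2.2.2.2.1 ▸ ht', h.2.2.2.2.2.2.symm⟩
    · rintro ⟨ht, rfl⟩
      refine ⟨_, ht, ?_⟩
      obtain ⟨e1, e2, e3, e4, e5⟩ := emit_eq_none_at_nameTime hG (r := r) (N.back v p)
      simp [e1, e2, e3, e4, e5]

theorem namesCorrectly (hG : G.Connected) (v : V) : NamesCorrectly N r v := by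
  have hT := isBFSTree_parentOf (N := N) (r := r) hG
  have hb : ∀ v t, (stateAt N r t v).underBridge.isSome = true ↔ reportTime N r v ≤ t := by
    intro v t
    rw [underBridge_stateAt hG]
    split_ifs with h <;> simp [h]
  have hbt : ∀ v t, reportTime N r v ≤ t →
      ((stateAt N r t v).underBridge = some true ↔ exits G (parentOf N r) v = ∅) := by
    intro v t ht
    rw [underBridge_stateAt hG, if_pos ht]
    simp
  have hk : ∀ v t, labelTime N r v ≤ t →
      (stateAt N r t v).preLabel.getD 0 = preorderLabel N (parentOf N r) v := by
    intro v t ht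
    rw [preLabel_stateAt hG, if_pos ht]
    rfl
  induction v using hT.root_induction with
  | root =>
    have h1 := labelTime_le_reportTime (N := N) (r := r) hG r
    constructor
    · intro t
      simp only [State.canName, leader_stateAt, decide_true, true_or, and_true, hb,
        preLabel_isSome hG, nameTime, SimpleGraph.dist_self, add_zero]
      omega
    · intro t ht
      simp only [nameTime, SimpleGraph.dist_self, add_zero] at ht
      rw [State.newComp, if_pos (Or.inl (by simp [leader_stateAt])), hk r t (h1.trans ht),
        hT.componentLabel_of_exits_eq_empty N hT.exits_root]
  | step v w hv ih =>
    obtain ⟨p, rfl⟩ := N.exists_port (hT.adj hv)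
    have hvr := hT.ne_root hv
    have h1 := labelTime_le_reportTime (N := N) (r := r) hG v
    have h2 := hT.dist_eq hv
    have h3 := dist_le_countTime (N := N) hG (r := r) v
    have h4 := countTime_le_reportTime (N := N) hG (r := r) v
    have h5 := reportTime_le_nameTime (N := N) hG (r := r) v
    have h6 : nameTime N r v = nameTime N r (N.nbr v p) + 1 := by
      simp only [nameTime]
      omega
    have hpar : ∀ t, G.dist r v ≤ t → (stateAt N r t v).heardFromParent Msg.component? =
        if nameTime N r (N.nbr v p) < t then
          some (componentLabel N (parentOf N r) (N.nbr v p)) else none := by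
      intro t ht
      rw [heardFromParent_eq hG _ ht hv]
      exact nbrComp_of_namesCorrectly hG ih
    constructor
    · intro t
      simp only [State.canName, leader_stateAt, hvr, decide_false, Bool.false_eq_true, false_or,
        hb, preLabel_isSome hG]
      by_cases ht : reportTime N r v ≤ t
      · rw [hpar t (by omega)]
        split_ifs with h <;> simp <;> omega
      · simp only [ht, false_and, and_false, false_iff]
        omega
    · intro t ht
      simp only [State.newComp, leader_stateAt, hvr, decide_false, Bool.false_eq_true, false_or,
        hbt v t (by omega)]
      split_ifs with he
      · rw [hk v t (by omega), hT.componentLabel_of_exits_eq_empty N he]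
      · rw [hpar t (by omega), if_pos (by omega), componentLabel_of_exits_ne_empty N hv he]
        rfl

theorem comp_stateAt (hG : G.Connected) : (stateAt N r t v).comp =
    if nameTime N r v ≤ t then some (componentLabel N (parentOf N r) v) else none :=
  (comp_of_namesCorrectly (namesCorrectly hG v) t).1

theorem emit6_eq (hG : G.Connected) (t : ℕ) (v : V) (p : Fin (N.deg v)) :
    emit6 N r t v p = if t = nameTime N r v then
      some (Msg.component (componentLabel N (parentOf N r) v)) else none :=
  emit6_eq_of_namesCorrectly (namesCorrectly hG v) t p

theorem nbrComp_stateAt (hG : G.Connected) : (stateAt N r t v).nbrComp p =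
    if nameTime N r (N.nbr v p) < t then
      some (componentLabel N (parentOf N r) (N.nbr v p)) else none :=
  nbrComp_of_namesCorrectly hG (namesCorrectly hG _)

end Phases

/-! ### The length of the messages -/

theorem length_encodeNat (k : ℕ) : (encodeNat k).length = 2 * k.size + 1 := by
  have : ∀ l : List Bool, (l.flatMap fun b => [true, b]).length = 2 * l.length := by
    intro l
    induction l with
    | nil => rfl
    | cons b l ih => simp [ih]; omega
  rw [encodeNat, List.length_append, this, Nat.size_eq_bits_len]
  rfl

/-- A message consists of at most three numbers, each at most `8 n`: the type of a message is at most
`8`, all other entries are at most `n`. -/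
theorem length_code_le {m : Msg} {n : ℕ} (hn : 2 ≤ n) (hm : ∀ k ∈ m.fields, k ≤ 8 * n) :
    m.code.length ≤ 33 * Nat.log 2 n := by
  have hlog : 1 ≤ Nat.log 2 n := Nat.log_pos (by norm_num) hn
  have hk : ∀ k ≤ 8 * n, (encodeNat k).length ≤ 11 * Nat.log 2 n := by
    intro k hk
    have h1 : n < 2 ^ (Nat.log 2 n + 1) := Nat.lt_pow_succ_log_self (by norm_num) n
    have h2 : k.size ≤ Nat.log 2 n + 4 := by
      rw [Nat.size_le]
      rw [pow_succ] at h1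
      rw [pow_add]
      omega
    rw [length_encodeNat]
    omega
  have key : ∀ l : List ℕ, (∀ k ∈ l, k ≤ 8 * n) →
      (l.flatMap encodeNat).length ≤ l.length * (11 * Nat.log 2 n) := by
    intro l
    induction l with
    | nil => simp
    | cons a l ih =>
      intro h
      rw [List.flatMap_cons, List.length_append, List.length_cons, Nat.succ_mul]
      have h1 := hk a (h a List.mem_cons_self)
      have h2 := ih fun k hk => h k (List.mem_cons_of_mem _ hk)
      omega
  have h3 : m.fields.length ≤ 3 := by cases m <;> simp [Msg.fields]
  calc m.code.length ≤ m.fields.length * (11 * Nat.log 2 n) := key _ hm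
    _ ≤ 3 * (11 * Nat.log 2 n) := Nat.mul_le_mul_right _ h3
    _ = 33 * Nat.log 2 n := by ring

theorem sum_deg {V : Type*} [Fintype V] {G : SimpleGraph V} (N : PortNumbering G) :
    ∑ v, N.deg v = 2 * G.edgeSet.ncard := by
  classical
  rw [Set.ncard_eq_toFinset_card', ← SimpleGraph.edgeFinset, ← G.sum_degrees_eq_twice_card_edges]
  refine Finset.sum_congr rfl fun v _ => ?_
  rw [← G.card_neighborSet_eq_degree, ← Fintype.card_congr (N.link v), Fintype.card_fin]

section Complexity

variable {V : Type*} [Fintype V] [DecidableEq V] {G : SimpleGraph V} {N : PortNumbering G} {r : V}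
  {t : ℕ} {v : V}

/-- All numbers sent are message types, numbers of nodes, or preorder labels. -/
theorem fields_le_of_out (hG : G.Connected) {p : Fin (N.deg v)} {m : Msg}
    (h : outAt N r t v p = some m) : ∀ k ∈ m.fields, k ≤ 8 * Fintype.card V := by
  have hT := isBFSTree_parentOf (N := N) (r := r) hG
  have hpos : 0 < Fintype.card V := Fintype.card_pos_iff.2 ⟨v⟩
  have hlab : ∀ u, treeLabel N r u ≤ Fintype.card V := hT.preorderLabel_le_card N
  rw [out_eq_some_iff, emit1_eq hG, emit2_eq hG, emit3_eq hG, emit4_eq hG, emit5_eq hG,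
    emit6_eq hG] at h
  rcases h with ⟨-, h⟩ | ⟨-, -, h⟩ | ⟨-, -, -, h⟩ | ⟨-, -, -, -, h⟩ | ⟨-, -, -, -, -, h⟩ |
    ⟨-, -, -, -, -, -, h⟩
  · split_ifs at h <;> cases h <;> simp [Msg.fields]; omega
  · split_ifs at h; cases h; simp [Msg.fields]; omega
  · split_ifs at h
    cases h
    have : numDescendants N r v ≤ Fintype.card V := by
      rw [numDescendants, ← Nat.card_eq_fintype_card]
      exact Set.ncard_le_card _
    simp [Msg.fields]
    omega
  · split_ifs at h with h1 h2 <;> cases h <;> simp [Msg.fields]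
    · have := hlab (N.nbr v p)
      omega
    · have := hlab v
      omega
  · split_ifs at h
    cases h
    rw [reportPair]
    split_ifs
    · simp [pairMsg, Msg.fields]; omega
    · have h1 := hT.le_card_of_mem_reachedLabels N (isLeast_lowLabel N (par := parentOf N r) v).1
      have h2 := hT.le_card_of_mem_reachedLabels N
        (isGreatest_highLabel N (par := parentOf N r) v).1
      simp [pairMsg, Msg.fields]
      omega
  · split_ifs at h
    cases h
    obtain ⟨u, hu, -⟩ := hT.exists_componentLabel N v
    have := hT.preorderLabel_le_card N u
    simp [Msg.fields]
    omega

theorem code_length_le (hG : G.Connected) {p : Fin (N.deg v)} {m : Msg}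
    (h : outAt N r t v p = some m) : m.code.length ≤ 33 * Nat.log 2 (Fintype.card V) := by
  refine length_code_le ?_ (fields_le_of_out hG h)
  exact Fintype.one_lt_card_iff.2 ⟨_, _, (N.adj_nbr v p).ne⟩

/-! ### The number of rounds -/

theorem outAt_eq_none_of_nameTime_lt (hG : G.Connected) (p : Fin (N.deg v))
    (ht : nameTime N r v < t) : outAt N r t v p = none := by
  have h1 : G.dist r v ≤ askTime N r v := Nat.le_add_left _ _
  have h2 := askTime_le_countTime hG (N := N) (r := r) v
  have h3 := countTime_le_labelTime hG (N := N) (r := r) v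
  have h4 := labelTime_le_reportTime hG (N := N) (r := r) v
  have h5 := reportTime_le_nameTime hG (N := N) (r := r) v
  rw [out_eq, emit1_eq hG, emit2_eq hG, emit3_eq hG, emit4_eq hG, emit5_eq hG, emit6_eq hG,
    if_neg (by omega), if_neg (by omega), if_neg (by omega), if_neg (by omega), if_neg (by omega),
    if_neg (by omega)]
  rfl

theorem messageCount_le (T : ℕ) :
    algorithm.messageCount N r T ≤ 12 * G.edgeSet.ncard := by
  have h : algorithm.messageCount N r T = ∑ v : V, ∑ t ∈ Finset.range T,
      (Finset.univ.filter fun p => (outAt N r t v p).isSome).card := Finset.sum_comm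
  rw [h]
  calc _ ≤ ∑ v : V, N.deg v * 6 := Finset.sum_le_sum fun v _ =>
        (sum_card_sent_le v T).trans (Nat.mul_le_mul_left _ (State.progress_le _))
    _ = 12 * G.edgeSet.ncard := by rw [← Finset.sum_mul, sum_deg]; ring

end Complexity

end EdgeBiconnectivity

/-- The algorithm computes a BFS tree, a preorder labelling, the cycle edges and bridges, and the
edge-biconnected components of every connected network with a leader `r`. It takes `O(Diam)` rounds,
and uses `O(m)` messages of `O(log n)` bits. -/
theorem mainTheorem1 :
    ∃ C : ℕ, ∀ (V : Type*) [Fintype V] [DecidableEq V] (G : SimpleGraph V) (_ : G.Connected)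
      (N : PortNumbering G) (r : V),
      -- every message has at most `C log n` bits
      (∀ t v p m, (EdgeBiconnectivity.algorithm.run N r t).out v p = some m →
        (EdgeBiconnectivity.algorithm.code m).length ≤ C * Nat.log 2 (Fintype.card V)) ∧
      ∃ T : ℕ,
        -- at most `C Diam` rounds, at most `C m` messages
        T ≤ C * G.diam ∧
        EdgeBiconnectivity.algorithm.messageCount N r T ≤ C * G.edgeSet.ncard ∧
        -- after `T` rounds all nodes have terminated
        (∀ v, EdgeBiconnectivity.algorithm.halted (N.deg v) ((EdgeBiconnectivity.algorithm.run N r T).state v) = true) ∧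
        (∀ t ≥ T, (EdgeBiconnectivity.algorithm.run N r t).state = (EdgeBiconnectivity.algorithm.run N r T).state ∧
          ∀ v p, (EdgeBiconnectivity.algorithm.run N r t).out v p = none) ∧
        -- the final states
        ∃ (s : ∀ v, EdgeBiconnectivity.State (N.deg v)) (par : V → Option V) (pre comp : V → ℕ),
          s = (EdgeBiconnectivity.algorithm.run N r T).state ∧
          -- the BFS tree, the numbers of descendants, the preorder
          (∀ v, par v = (s v).parent.map (N.nbr v)) ∧
          IsBFSTree G r par ∧
          (∀ v, (s v).numDesc = some (descendants par v).ncard) ∧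
          (∀ v, (s v).preLabel = some (pre v)) ∧
          IsPreorderLabelling par pre ∧
          -- the marks on the tree edges
          (∀ v w, par v = some w →
            ((s v).underBridge = some true ↔ G.IsBridge s(v, w)) ∧
            ((s v).underBridge = some false ↔ InSimpleCycle G s(v, w))) ∧
          -- the component labels
          (∀ v, (s v).comp = some (comp v)) ∧
          (∀ v w, comp v = comp w ↔ SameEdgeComponent G v w) ∧
          -- the verdicts of the nodes on their incident edges
          (∀ v p, ((s v).isBridgeAt p = true ↔ G.IsBridge s(v, N.nbr v p)) ∧
            ((s v).isBridgeAt p = false ↔ InSimpleCycle G s(v, N.nbr v p))) := by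
  refine ⟨33, fun V _ _ G hG N r => ⟨fun t v p m h => EdgeBiconnectivity.code_length_le hG h, ?_⟩⟩
  have hT := EdgeBiconnectivity.isBFSTree_parentOf (N := N) (r := r) hG
  have hname := EdgeBiconnectivity.nameTime_le (N := N) (r := r) hG
  have hdelay := EdgeBiconnectivity.delay_le_diam (N := N) (r := r) hG
  let T := 5 * G.diam + 4 * EdgeBiconnectivity.delay N r
  have hTname : ∀ v, EdgeBiconnectivity.nameTime N r v ≤ T := fun v => (hname v).trans (by omega)
  have hrep : ∀ v, EdgeBiconnectivity.reportTime N r v ≤ T := fun v => by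
    have h1 := EdgeBiconnectivity.reportTime_le_nameTime hG (N := N) (r := r) v
    have h2 := hTname v
    omega
  have hlab : ∀ v, EdgeBiconnectivity.labelTime N r v ≤ T := fun v =>
    (EdgeBiconnectivity.labelTime_le_reportTime hG v).trans (hrep v)
  have hcount : ∀ v, EdgeBiconnectivity.countTime N r v ≤ T := fun v =>
    (EdgeBiconnectivity.countTime_le_reportTime hG v).trans (hrep v)
  have hdist : ∀ v, G.dist r v ≤ T := fun v =>
    (EdgeBiconnectivity.dist_le_countTime hG v).trans (hcount v)
  -- A port exists only if there are two nodes; one more round is needed then for the last messages.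
  have hlt : ∀ (v u : V) (_ : Fin (N.deg v)), EdgeBiconnectivity.nameTime N r u < T := by
    intro v u p
    have h1 := EdgeBiconnectivity.delay_eq_one (r := r) hG p
    have h2 := hname u
    omega
  have hcomp : ∀ v, (EdgeBiconnectivity.stateAt N r T v).comp =
      some (componentLabel N (EdgeBiconnectivity.parentOf N r) v) := fun v => by
    rw [EdgeBiconnectivity.comp_stateAt hG, if_pos (hTname v)]
  have hnbr : ∀ v p, (EdgeBiconnectivity.stateAt N r T v).nbrComp p =
      some (componentLabel N (EdgeBiconnectivity.parentOf N r) (N.nbr v p)) := fun v p => by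
    rw [EdgeBiconnectivity.nbrComp_stateAt hG, if_pos (hlt v _ p)]
  have hsilent : ∀ t ≥ T, ∀ v p, EdgeBiconnectivity.outAt N r t v p = none := fun t ht v p =>
    EdgeBiconnectivity.outAt_eq_none_of_nameTime_lt hG p ((hlt v v p).trans_le ht)
  refine ⟨T, by omega, (EdgeBiconnectivity.messageCount_le T).trans (by omega), ?_, ?_,
    EdgeBiconnectivity.stateAt N r T, EdgeBiconnectivity.parentOf N r,
    preorderLabel N (EdgeBiconnectivity.parentOf N r),
    componentLabel N (EdgeBiconnectivity.parentOf N r), rfl, ?_, hT, ?_, ?_,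
    hT.isPreorderLabelling N, ?_, hcomp, hT.componentLabel_eq_iff N, ?_⟩
  · intro v
    change (EdgeBiconnectivity.stateAt N r T v).halted = true
    simp [EdgeBiconnectivity.State.halted, hcomp, hnbr]
  · intro t ht
    refine ⟨?_, hsilent t ht⟩
    change EdgeBiconnectivity.stateAt N r t = EdgeBiconnectivity.stateAt N r T
    induction t, ht using Nat.le_induction with
    | base => rfl
    | succ t ht ih =>
      rw [← ih]
      exact funext (EdgeBiconnectivity.stateAt_succ_of_silent (hsilent t ht))
  · intro v
    rw [EdgeBiconnectivity.parent_stateAt hG (hdist v)]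
    rfl
  · intro v
    rw [EdgeBiconnectivity.numDesc_stateAt hG, if_pos (hcount v)]
    rfl
  · intro v
    rw [EdgeBiconnectivity.preLabel_stateAt hG, if_pos (hlab v)]
    rfl
  · intro v w hv
    rw [EdgeBiconnectivity.underBridge_stateAt hG, if_pos (hrep v),
      inSimpleCycle_iff_not_isBridge (hT.adj hv), hT.isBridge_iff_exits hv]
    simp
  · intro v p
    have hadj := N.adj_nbr v p
    rw [inSimpleCycle_iff_not_isBridge hadj, ← sameEdgeComponent_iff_not_isBridge hadj,
      ← not_iff_not (b := G.IsBridge _), ← sameEdgeComponent_iff_not_isBridge hadj,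
      ← hT.componentLabel_eq_iff N]
    simp [EdgeBiconnectivity.State.isBridgeAt, hcomp, hnbr]
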